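/- Let $N\ge 3$. Objects $1,\dots,N$ appear one by one at moments $1,\dots,N$, all orders of their absolute ranks being equally likely. Let $R_n$ be the rank of the $n$-th object among the first $n$ objects (rank 1 is best). For $1\le n\le N$ put $$S_{1,n}=\sum_{k=n+1}^{N}\frac1{k-1},\qquad S_{2,n}=\sum_{k=n+1}^{N}\frac{n-1}{(k-1)(k-2)}\quad(n\ge 2),$$ and let $n^*$ be the least $n\ge 1$ with $S_{1,n}\le 1$ (so $n^*\geq 2$). Player 1 accepts the first object with $R_n=1$ that appears at a moment $n\ge n^*$. Player 2 observes all the other objects in the same order, learning only the rank $S_j$ of the $j$-th object that he observes among the first $j$ objects that he observes; he decides on each observed object, when it appears, on the basis of $S_1,\dots,S_j$ only, may accept one object, and obtains 1 if it is the best of all $N$ objects and 0 otherwise. A candidate is an object that is the best of those observed by Player 2 so far. For $m\ge1$ let $\mu_m$ be the moment at which the $m$-th candidate after moment $n^*$ appears. Optimal rewards. Each of the following is the supremum, over the strategies of Player 2, of his conditional probability of obtaining the best object when he has accepted none of the first $n$ objects: $v(n,-1)$, $0\le n\le N$, given that Player 1 has accepted none of the first $n$ objects; $v(n,0)$, $n^*\le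 n\le N$, given that Player 1 has accepted one of the first $n$ objects and no candidate has appeared since; and, for a history $H$ (the ranks observed by Player 2 up to moment $n$) with $\mu_m=n$, $m\geq 1$, $v(n,p_{m,n,H})$ given $H$ (here $p_{m,n,H}=P(R_n=1\mid H)$). Near-optimal count-based rule. It replaces $p_{m,n,H}$ by $\frac m{m+1}$. Put $K(n)=\lceil S_{2,n}/(1-S_{1,n})\rceil$ for $n>n^*$, and let $n_m$ be the least $n>n^*$ with $K(n)\le m$. For $m\ge 0$ and $n^*+m\le n\le N$ define $v^a(n,m)$ recursively as follows: if $n\ge n_{m+1}-1$, $$v^a(n,m)=\frac{mn}{N(m+1)}\sum_{k=n+1}^N\frac1{k-1}+\frac{n(n-1)}{N(m+1)}\sum_{k=n+1}^N\frac1{(k-1)(k-2)},$$ and if $n<n_{m+1}-1$, $$v^a(n,m)=\sum_{k=n+1}^{n_{m+1}-1}\left[\frac{mn}{(m+1)k(k-1)}+\frac{2n(n-1)}{(m+1)k(k-1)(k-2)}\right]v^a(k,m+1)+\sum_{k=n_{m+1}}^{N}\left[\frac{mn}{(m+1)N(k-1)}+\frac{n(n-1)}{(m+1)N(k-1)(k-2)}\right].$$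 Further, for $n^*-1\le n\le N$ let $v^a(n,-1)=\sum_{k=n+1}^N\frac{n\,v^a(k,0)}{k(k-1)}$, and for $0\le n<n^*-1$ let $$v^a(n,-1)=\sum_{k=n+1}^{n^*-1}r(n,k)\max\left\{\frac kN,\,v^a(k,-1)\right\}+\frac{n}{n^*-1}\,v^a(n^*-1,-1),$$ where $r(n,k)=\frac n{k(k-1)}$ for $n\ge1$ is the probability that the first object of relative rank 1 after moment $n$ appears at moment $k$, with $r(0,1)=1$ and $r(0,k)=0$ for $k\ge2$. Then $v^a$ is a lower bound on the corresponding optimal expected future reward: $v^a(n,-1)\le v(n,-1)$ for all $0\le n\le N$; $v^a(n,0)\le v(n,0)$ for all $n^*\le n\le N$; and $v^a(n,m)\le v(n,p_{m,n,H})$ for all $m\ge1$, all $n$, and every history $H$ of Player 2 with $\mu_m=n$. -/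

import Mathlib

noncomputable section

namespace StackelbergSecretary

open scoped Classical

/-! ## The threshold of Player 1 and the count-based thresholds of Player 2

Moments are the natural numbers `1, …, N`. -/

/-- `S_{1,n} = ∑_{k=n+1}^N 1/(k-1)`. -/
def S₁ (N n : ℕ) : ℝ :=
  ∑ k ∈ Finset.Icc (n + 1) N, 1 / ((k : ℝ) - 1)

/-- `S_{2,n} = ∑_{k=n+1}^N (n-1)/((k-1)(k-2))`. -/
def S₂ (N n : ℕ) : ℝ :=
  ∑ k ∈ Finset.Icc (n + 1) N, ((n : ℝ) - 1) / (((k : ℝ) - 1) * ((k : ℝ) - 2))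

/-- The moment `n*` from which Player 1 (optimally) accepts the first relatively best object:
the least moment `n ≥ 1` with `∑_{k=n+1}^N 1/(k-1) ≤ 1`. -/
def nStar (N : ℕ) : ℕ :=
  sInf {n : ℕ | 1 ≤ n ∧ S₁ N n ≤ 1}

/-- `K(n) = ⌈S_{2,n} / (1 - S_{1,n})⌉`. -/
def K (N n : ℕ) : ℤ :=
  ⌈S₂ N n / (1 - S₁ N n)⌉

/-- `n_m`: the least moment `n > n*` with `K(n) ≤ m`. The near-optimal rule accepts the `m`-th
candidate after `n*` if and only if it appears at moment `n_m` or later. -/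
def threshold (N m : ℕ) : ℕ :=
  sInf {n : ℕ | nStar N < n ∧ K N n ≤ (m : ℤ)}

/-! ## The value function of the near-optimal count-based rule -/

/-- `w^a(n,m)`: the estimated reward from accepting the next candidate, starting in `(n,m)`. -/
def wApprox (N n m : ℕ) : ℝ :=
  (m : ℝ) * n / (N * ((m : ℝ) + 1)) * (∑ k ∈ Finset.Icc (n + 1) N, 1 / ((k : ℝ) - 1))
  + (n : ℝ) * ((n : ℝ) - 1) / (N * ((m : ℝ) + 1))
      * (∑ k ∈ Finset.Icc (n + 1) N, 1 / (((k : ℝ) - 1) * ((k : ℝ) - 2)))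

/-- `v^a(n,m)` for `m ≥ 0`. If `n ≥ n_{m+1} - 1`, then the next candidate is accepted whenever it
appears. Otherwise one conditions on the moment `k` at which the next candidate appears: it is
rejected if `k < n_{m+1}` and accepted if `k ≥ n_{m+1}`. -/
def vApprox (N n m : ℕ) : ℝ :=
  if threshold N (m + 1) ≤ n + 1 then wApprox N n m
  else
    (∑ k ∈ ((Finset.Icc (n + 1) N).filter (fun k => k < threshold N (m + 1))).attach,
      ((m : ℝ) * n / (((m : ℝ) + 1) * (k.1 : ℝ) * ((k.1 : ℝ) - 1))
        + 2 * (n : ℝ) * ((n : ℝ) - 1)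
            / (((m : ℝ) + 1) * (k.1 : ℝ) * ((k.1 : ℝ) - 1) * ((k.1 : ℝ) - 2)))
        * vApprox N k.1 (m + 1))
    + ∑ k ∈ Finset.Icc (threshold N (m + 1)) N,
      ((m : ℝ) * n / (((m : ℝ) + 1) * N * ((k : ℝ) - 1))
        + (n : ℝ) * ((n : ℝ) - 1) / (((m : ℝ) + 1) * N * ((k : ℝ) - 1) * ((k : ℝ) - 2)))
termination_by N - n
decreasing_by
  have hk := k.2
  simp only [Finset.mem_filter, Finset.mem_Icc] at hk
  omega

/-- The probability that the first object of relative rank 1 after moment `n` appears at moment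
`k > n`: this is `n/(k(k-1))`; for `n = 0` the very first object has relative rank 1. -/
def nextBestProb (n k : ℕ) : ℝ :=
  if n = 0 then (if k = 1 then 1 else 0) else (n : ℝ) / ((k : ℝ) * ((k : ℝ) - 1))

/-- `v^a(n,-1)`. For `n ≥ n* - 1` one conditions on the moment at which Player 1 accepts an
object. For `n < n* - 1` one conditions on the moment `k` of the next object of relative rank 1,
which Player 2 may accept if `k < n*`; no such object appears before `n*` with probability
`n/(n*-1)`. -/
def vApproxBefore (N n : ℕ) : ℝ :=
  if nStar N ≤ n + 1 then
    ∑ k ∈ Finset.Icc (n + 1) N, (n : ℝ) * vApprox N k 0 / ((k : ℝ) * ((k : ℝ) - 1))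
  else
    (∑ k ∈ (Finset.Ico (n + 1) (nStar N)).attach,
      nextBestProb n k.1 * max ((k.1 : ℝ) / N) (vApproxBefore N k.1))
    + vApproxBefore N (nStar N - 1) * ((n : ℝ) / ((nStar N : ℝ) - 1))
termination_by nStar N - n
decreasing_by
  · have hk := k.2
    simp only [Finset.mem_Ico] at hk
    omega
  · omega

/-! ## The game

A sample point is a permutation `ω` of `Fin N`, all permutations being equally likely. The object
with index `i : Fin N` appears at moment `i + 1` and has absolute rank `ω i + 1`
(so `ω i = 0` says that it is the best of all the objects). -/

variable {N : ℕ}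

/-- `R_{i+1}`: the rank of object `i` among the objects that have appeared by then. -/
def relRank (ω : Equiv.Perm (Fin N)) (i : Fin N) : ℕ :=
  (Finset.univ.filter (fun j : Fin N => j ≤ i ∧ ω j ≤ ω i)).card

/-- Player 1 accepts object `i`: it is the first object of relative rank 1 to appear at or after
moment `n*`. -/
def IsTaken (ω : Equiv.Perm (Fin N)) (i : Fin N) : Prop :=
  nStar N ≤ (i : ℕ) + 1 ∧ relRank ω i = 1 ∧
    ∀ j : Fin N, j < i → nStar N ≤ (j : ℕ) + 1 → relRank ω j ≠ 1

/-- Player 1 has accepted one of the first `n` objects. -/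
def TakenBy (ω : Equiv.Perm (Fin N)) (n : ℕ) : Prop :=
  ∃ i : Fin N, (i : ℕ) + 1 ≤ n ∧ IsTaken ω i

/-- The rank of object `i` with respect to the objects that Player 2 has observed by then; he
observes all the objects except for the one accepted by Player 1. -/
def seenRank (ω : Equiv.Perm (Fin N)) (i : Fin N) : ℕ :=
  (Finset.univ.filter (fun j : Fin N => j ≤ i ∧ ¬ IsTaken ω j ∧ ω j ≤ ω i)).card

/-- Object `i` is a candidate according to Player 2: he observes it, and it is the best of the
objects observed by him so far. -/
def IsCandidate (ω : Equiv.Perm (Fin N)) (i : Fin N) : Prop :=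
  ¬ IsTaken ω i ∧ seenRank ω i = 1

/-- The number of candidates according to Player 2 to appear after moment `n*` and no later than
moment `n`. -/
def candidateCount (ω : Equiv.Perm (Fin N)) (n : ℕ) : ℕ :=
  (Finset.univ.filter
    (fun i : Fin N => nStar N < (i : ℕ) + 1 ∧ (i : ℕ) + 1 ≤ n ∧ IsCandidate ω i)).card

/-- `μ_m = n`: the `m`-th candidate according to Player 2 after moment `n*` appears at
moment `n`. -/
def IsCandidateTime (ω : Equiv.Perm (Fin N)) (m n : ℕ) : Prop :=
  nStar N < n ∧ (∃ i : Fin N, (i : ℕ) + 1 = n ∧ IsCandidate ω i) ∧ candidateCount ω n = m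

/-- The history of Player 2 at moment `n`: the ranks `S_1, S_2, …` of the objects that he has
observed, each with respect to the objects previously observed by him, in order of appearance. -/
def history (ω : Equiv.Perm (Fin N)) (n : ℕ) : List ℕ :=
  ((List.finRange N).filter (fun i : Fin N => (i : ℕ) + 1 ≤ n ∧ ¬ IsTaken ω i)).map (seenRank ω)

/-- A strategy of Player 2: having observed an object, he decides whether to accept it on the
basis of his history up to and including this object, and of nothing else. -/
abbrev Strategy : Type := List ℕ → Bool

/-- Player 2, observing object `i`, is told by `σ` to accept it. -/
def Wants (σ : Strategy) (ω : Equiv.Perm (Fin N)) (i : Fin N) : Prop :=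
  ¬ IsTaken ω i ∧ σ (history ω ((i : ℕ) + 1)) = true

/-- Player 2, still searching after moment `n` and using `σ` from then on, obtains the best of
all the objects. -/
def WinsAfter (n : ℕ) (σ : Strategy) (ω : Equiv.Perm (Fin N)) : Prop :=
  ∃ i : Fin N, n < (i : ℕ) + 1 ∧ Wants σ ω i ∧
    (∀ j : Fin N, n < (j : ℕ) + 1 → j < i → ¬ Wants σ ω j) ∧ (ω i : ℕ) = 0

/-- The conditional probability of `A` given `E` for a uniformly distributed permutation. -/
def condProb (A E : Set (Equiv.Perm (Fin N))) : ℝ :=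
  ((A ∩ E).ncard : ℝ) / (E.ncard : ℝ)

/-- The optimal expected future reward of Player 2 (the probability of obtaining the best of all
the objects), given the event `E`, when he has not accepted any of the first `n` objects. -/
def optimalReward (n : ℕ) (E : Set (Equiv.Perm (Fin N))) : ℝ :=
  ⨆ σ : Strategy, condProb {ω | WinsAfter n σ ω} E

variable (N) in
/-- `v(n,-1)`: neither player has accepted any of the first `n` objects. -/
def vBefore (n : ℕ) : ℝ :=
  optimalReward n {ω : Equiv.Perm (Fin N) | ¬ TakenBy ω n}

variable (N) in
/-- `v(n,0)`: Player 1 has accepted one of the first `n` objects, and Player 2 has not observed a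
candidate since. -/
def vZero (n : ℕ) : ℝ :=
  optimalReward n {ω : Equiv.Perm (Fin N) | TakenBy ω n ∧ candidateCount ω n = 0}

/-- `v(n,p_{m,n,H})`, where `H` is the history of Player 2 at moment `n` in the realization `ω`. -/
def vAt (ω : Equiv.Perm (Fin N)) (n : ℕ) : ℝ :=
  optimalReward n {ω' : Equiv.Perm (Fin N) | history ω' n = history ω n}

end StackelbergSecretary

end

noncomputable section

namespace StackelbergSecretary

open scoped Classical

/-! ## The value of the game in which Player 2 only observes the candidates -/

/-- The weights `γ`, `α`, `β` are those of the events that Player 1 has not accepted any of the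
first `n` objects, that he has accepted one which is not the best so far, and that he has accepted
the best so far. -/
def gameValue (N n : ℕ) (γ α β : ℝ) : ℝ :=
  if n < N then
    gameValue N (n + 1) (n * γ / (n + 1)) (n * α / (n + 1)) (((n - 1) * β + γ) / (n + 1))
      + max ((α + β) / N) (gameValue N (n + 1) 0 ((α + β) / (n + 1)) (β / (n + 1)))
  else 0
termination_by N - n

theorem gameValue_of_lt {N n : ℕ} (h : n < N) (γ α β : ℝ) :
    gameValue N n γ α β =
      gameValue N (n + 1) (n * γ / (n + 1)) (n * α / (n + 1)) (((n - 1) * β + γ) / (n + 1))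
      + max ((α + β) / N) (gameValue N (n + 1) 0 ((α + β) / (n + 1)) (β / (n + 1))) := by
  rw [gameValue, if_pos h]

theorem gameValue_of_le {N n : ℕ} (h : N ≤ n) (γ α β : ℝ) : gameValue N n γ α β = 0 := by
  rw [gameValue, if_neg (by omega)]

/-- Downward induction from `N`. -/
theorem downward_induction {N : ℕ} {P : ℕ → Prop} (hbase : ∀ n, N ≤ n → P n)
    (hstep : ∀ n, n < N → P (n + 1) → P n) (n : ℕ) : P n := by
  by_cases h : N ≤ n
  · exact hbase n h
  · have : ∀ l, ∀ n, N - n = l → P n := by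
      intro l
      induction l with
      | zero => exact fun n hn => hbase n (by omega)
      | succ l ih => exact fun n hn => hstep n (by omega) (ih (n + 1) (by omega))
    exact this _ n rfl

theorem gameValue_add_le (N n : ℕ) : ∀ γ α β γ' α' β' : ℝ,
    gameValue N n (γ + γ') (α + α') (β + β') ≤ gameValue N n γ α β + gameValue N n γ' α' β' := by
  induction n using downward_induction (N := N) with
  | hbase n h => intros; simp [gameValue_of_le h]
  | hstep n h ih =>
    intro γ α β γ' α' β'
    have h1 := ih (n * γ / (n + 1)) (n * α / (n + 1)) (((n - 1) * β + γ) / (n + 1))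
      (n * γ' / (n + 1)) (n * α' / (n + 1)) (((n - 1) * β' + γ') / (n + 1))
    have h2 := ih 0 ((α + β) / (n + 1)) (β / (n + 1)) 0 ((α' + β') / (n + 1)) (β' / (n + 1))
    simp only [gameValue_of_lt h]
    have e1 : (n : ℝ) * (γ + γ') / (n + 1) = n * γ / (n + 1) + n * γ' / (n + 1) := by ring
    have e2 : (n : ℝ) * (α + α') / (n + 1) = n * α / (n + 1) + n * α' / (n + 1) := by ring
    have e3 : (((n : ℝ) - 1) * (β + β') + (γ + γ')) / (n + 1)
        = ((n - 1) * β + γ) / (n + 1) + ((n - 1) * β' + γ') / (n + 1) := by ring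
    have e4 : (α + α' + (β + β')) / ((n : ℝ) + 1)
        = (α + β) / (n + 1) + (α' + β') / (n + 1) := by ring
    have e5 : (β + β') / ((n : ℝ) + 1) = β / (n + 1) + β' / (n + 1) := by ring
    have e6 : (α + α' + (β + β')) / (N : ℝ) = (α + β) / N + (α' + β') / N := by ring
    rw [e1, e2, e3, e4, e5, e6]
    rw [add_zero] at h2
    have := max_le (add_le_add (le_max_left ((α + β) / (N : ℝ))
      (gameValue N (n + 1) 0 ((α + β) / (n + 1)) (β / (n + 1)))) (le_max_left ((α' + β') / (N : ℝ))
      (gameValue N (n + 1) 0 ((α' + β') / (n + 1)) (β' / (n + 1)))))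
      (h2.trans (add_le_add (le_max_right ((α + β) / (N : ℝ)) _)
        (le_max_right ((α' + β') / (N : ℝ)) _)))
    linarith

theorem gameValue_smul (N n : ℕ) : ∀ {c : ℝ}, 0 ≤ c → ∀ γ α β : ℝ,
    gameValue N n (c * γ) (c * α) (c * β) = c * gameValue N n γ α β := by
  induction n using downward_induction (N := N) with
  | hbase n h => intros; simp [gameValue_of_le h]
  | hstep n h ih =>
    intro c hc γ α β
    simp only [gameValue_of_lt h]
    rw [mul_add, mul_max_of_nonneg _ _ hc, ← ih hc, ← ih hc]
    congr 2 <;> ring_nf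

theorem gameValue_nonneg (N n : ℕ) : 1 ≤ n → ∀ {γ α β : ℝ}, 0 ≤ α → 0 ≤ β →
    0 ≤ γ → 0 ≤ gameValue N n γ α β := by
  induction n using downward_induction (N := N) with
  | hbase n h => intros; simp [gameValue_of_le h]
  | hstep n h ih =>
    intro hn γ α β hα hβ hγ
    rw [gameValue_of_lt h]
    have hn' : (1 : ℝ) ≤ n := by exact_mod_cast hn
    have h1 : 0 ≤ ((n : ℝ) - 1) * β := mul_nonneg (by linarith) hβ
    exact add_nonneg (ih (by omega) (by positivity) (by positivity) (by positivity))
      (le_max_of_le_left (by positivity))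

/-- It is worst for Player 2 if the object accepted by Player 1 is surely the best so far. -/
theorem gameValue_zero_le (N n : ℕ) : 1 ≤ n → ∀ {α β : ℝ}, 0 ≤ α → 0 ≤ β →
    gameValue N n 0 0 (α + β) ≤ gameValue N n 0 α β := by
  induction n using downward_induction (N := N) with
  | hbase n h => intros; simp [gameValue_of_le h]
  | hstep n h ih =>
    intro hn α β hα hβ
    have hn' : (1 : ℝ) ≤ n := by exact_mod_cast hn
    simp only [gameValue_of_lt h, mul_zero, zero_div, zero_add, add_zero]
    have h1 : 0 ≤ (n : ℝ) * α / (n + 1) := by positivity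
    have h2 : 0 ≤ ((n : ℝ) - 1) * β / (n + 1) :=
      div_nonneg (mul_nonneg (by linarith) hβ) (by positivity)
    have h3 := ih (by omega) h1 h2
    have lin : gameValue N (n + 1) 0 0 (n * α / (n + 1) + (n - 1) * β / (n + 1))
        = gameValue N (n + 1) 0 0 ((n - 1) * (α + β) / (n + 1))
          + gameValue N (n + 1) 0 0 (α / (n + 1)) := by
      have hs : ∀ x : ℝ, 0 ≤ x → gameValue N (n + 1) 0 0 x = x * gameValue N (n + 1) 0 0 1 := by
        intro x hx
        have := gameValue_smul N (n + 1) hx 0 0 1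
        simpa using this
      rw [hs _ (add_nonneg h1 h2), hs (α / (n + 1)) (by positivity),
        hs _ (div_nonneg (mul_nonneg (by linarith) (by positivity)) (by positivity))]
      ring
    have h4 : 0 ≤ gameValue N (n + 1) 0 0 (α / (n + 1)) :=
      gameValue_nonneg N (n + 1) (by omega) le_rfl (by positivity) le_rfl
    have h5 := gameValue_add_le N (n + 1) 0 ((α + β) / (n + 1)) (β / (n + 1)) 0 0 (α / (n + 1))
    have e : β / ((n : ℝ) + 1) + α / (n + 1) = (α + β) / (n + 1) := by ring
    rw [e, add_zero, add_zero] at h5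
    have h6 : max ((α + β) / N)
        (gameValue N (n + 1) 0 ((α + β) / (n + 1)) ((α + β) / (n + 1)))
        ≤ max ((α + β) / N) (gameValue N (n + 1) 0 ((α + β) / (n + 1)) (β / (n + 1)))
          + gameValue N (n + 1) 0 0 (α / (n + 1)) := by
      refine max_le ?_ ?_
      · have := le_max_left ((α + β) / (N : ℝ))
          (gameValue N (n + 1) 0 ((α + β) / (n + 1)) (β / (n + 1)))
        linarith
      · have := le_max_right ((α + β) / (N : ℝ))
          (gameValue N (n + 1) 0 ((α + β) / (n + 1)) (β / (n + 1)))
        linarith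
    linarith

theorem gameValue_mono (N n : ℕ) (hn : 1 ≤ n) {α β α' β' : ℝ} (hα' : 0 ≤ α') (hβ : 0 ≤ β)
    (h : α' ≤ α) (hs : α' + β' = α + β) : gameValue N n 0 α' β' ≤ gameValue N n 0 α β := by
  rcases eq_or_lt_of_le (hα'.trans h) with h0 | h0
  · obtain rfl : α' = α := by linarith
    obtain rfl : β' = β := by linarith
    exact le_rfl
  · have hl0 : 0 ≤ α' / α := by positivity
    have hl1 : 0 ≤ 1 - α' / α := by
      rw [sub_nonneg, div_le_one h0]; exact h
    have h1 := gameValue_add_le N n 0 (α' / α * α) (α' / α * β) 0 0 ((1 - α' / α) * (α + β))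
    have h2 := gameValue_smul N n hl0 0 α β
    have h3 := gameValue_smul N n hl1 0 0 (α + β)
    have h4 := gameValue_zero_le N n hn (α := α) h0.le hβ
    rw [mul_zero] at h2 h3
    have e1 : α' / α * α = α' := by field_simp
    have e2 : α' / α * β + (1 - α' / α) * (α + β) = β' := by
      have : β' = α + β - α' := by linarith
      rw [this]; field_simp; ring
    rw [h2, h3, e2, add_zero, add_zero, e1] at h1
    nlinarith [mul_le_mul_of_nonneg_left h4 hl1]

theorem gameValue_add_of_zero (N n : ℕ) : 1 ≤ n → ∀ {γ β : ℝ}, 0 ≤ γ → 0 ≤ β →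
    gameValue N n γ 0 0 + gameValue N n 0 0 β ≤ gameValue N n γ 0 β := by
  induction n using downward_induction (N := N) with
  | hbase n h => intros; simp [gameValue_of_le h]
  | hstep n h ih =>
    intro hn γ β hγ hβ
    have hn' : (1 : ℝ) ≤ n := by exact_mod_cast hn
    have hz : gameValue N (n + 1) 0 0 0 = 0 := by
      simpa using gameValue_smul N (n + 1) (le_refl 0) 0 0 0
    simp only [gameValue_of_lt h, mul_zero, zero_div, zero_add, add_zero, hz, max_self]
    have hs : ∀ x : ℝ, 0 ≤ x → gameValue N (n + 1) 0 0 x = x * gameValue N (n + 1) 0 0 1 := by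
      intro x hx
      simpa using gameValue_smul N (n + 1) hx 0 0 1
    have h1 : 0 ≤ ((n : ℝ) - 1) * β := mul_nonneg (by linarith) hβ
    have h2 := ih (by omega) (γ := n * γ / (n + 1)) (β := ((n - 1) * β + γ) / (n + 1))
      (by positivity) (by positivity)
    have h3 := gameValue_add_le N (n + 1) (n * γ / (n + 1)) 0 0 0 0 (γ / (n + 1))
    simp only [zero_add, add_zero] at h3
    rw [hs _ (by positivity)] at h2 h3
    rw [hs ((n - 1) * β / (n + 1)) (by positivity)]
    have e : ((n - 1) * β + γ) / ((n : ℝ) + 1) = (n - 1) * β / (n + 1) + γ / (n + 1) := by ring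
    rw [e] at h2 ⊢
    linarith

/-! ## Comparison of the count-based value function with `gameValue` -/

/-- The reward from moment `n` on, with weights `α`, `β`, if the next candidate is accepted if and
only if it appears at moment `t` or later, and `u k` is obtained if it appears at `k < t`. -/
def stepReward (N t : ℕ) (u : ℕ → ℝ) (n : ℕ) (α β : ℝ) : ℝ :=
  ∑ k ∈ Finset.Icc (n + 1) N,
    if k < t then
      (α * n / (k * ((k : ℝ) - 1))
        + 2 * β * n * ((n : ℝ) - 1) / (k * ((k : ℝ) - 1) * ((k : ℝ) - 2))) * u k
    else α * n / (N * ((k : ℝ) - 1))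
      + β * n * ((n : ℝ) - 1) / (N * ((k : ℝ) - 1) * ((k : ℝ) - 2))

theorem stepReward_of_lt {N n : ℕ} (hn : 2 ≤ n) (h : n < N) (t : ℕ) (u : ℕ → ℝ) (α β : ℝ) :
    stepReward N t u n α β =
      stepReward N t u (n + 1) (n * α / (n + 1)) ((n - 1) * β / (n + 1))
      + if n + 1 < t then (α + 2 * β) / (n + 1) * u (n + 1) else (α + β) / N := by
  have hn' : (2 : ℝ) ≤ n := by exact_mod_cast hn
  have hN : (0 : ℝ) < N := by exact_mod_cast (by omega : 0 < N)
  unfold stepReward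
  rw [← Finset.insert_Icc_add_one_left_eq_Icc (by omega : n + 1 ≤ N),
    Finset.sum_insert (by simp), add_comm]
  congr 1
  · refine Finset.sum_congr rfl fun k hk => ?_
    have hk' : ((n : ℝ) + 2) ≤ k := by
      have := (Finset.mem_Icc.1 hk).1
      exact_mod_cast this
    have k0 : (k : ℝ) ≠ 0 := by linarith
    have k1 : (k : ℝ) - 1 ≠ 0 := by linarith
    have k2 : (k : ℝ) - 2 ≠ 0 := by linarith
    have n0 : (n : ℝ) + 1 ≠ 0 := by linarith
    split_ifs
    · congr 1
      push_cast
      field_simp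
      ring
    · push_cast
      field_simp
      ring
  · have n0 : (n : ℝ) + 1 ≠ 0 := by linarith
    have n1 : (n : ℝ) ≠ 0 := by linarith
    have n2 : (n : ℝ) - 1 ≠ 0 := by linarith
    have e1 : (((n + 1 : ℕ) : ℝ) - 1) = n := by push_cast; ring
    have e2 : (((n + 1 : ℕ) : ℝ) - 2) = n - 1 := by push_cast; ring
    split_ifs
    · rw [e1, e2]
      congr 1
      push_cast
      field_simp
    · rw [e1, e2]
      field_simp

theorem stepReward_le_gameValue {N m t : ℕ} {u : ℕ → ℝ} (n : ℕ) :
    2 ≤ n → (∀ k, n < k → k ≤ N → ∀ α β : ℝ, 0 ≤ β → (m + 1) * β ≤ α →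
      u k * (α + β) ≤ gameValue N k 0 α β) →
    ∀ {α β : ℝ}, 0 ≤ β → m * β ≤ α → stepReward N t u n α β ≤ gameValue N n 0 α β := by
  induction n using downward_induction (N := N) with
  | hbase n h =>
    intros
    rw [gameValue_of_le h, stepReward, Finset.Icc_eq_empty (by omega), Finset.sum_empty]
  | hstep n h ih =>
    intro hn hu α β hβ hα
    have hn' : (2 : ℝ) ≤ n := by exact_mod_cast hn
    rw [gameValue_of_lt h, stepReward_of_lt hn h]
    simp only [mul_zero, zero_div, add_zero]
    refine add_le_add ?_ ?_
    · refine ih (by omega) (fun k hk => hu k (by omega))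
        (div_nonneg (mul_nonneg (by linarith) hβ) (by positivity)) ?_
      rw [← mul_div_assoc]
      gcongr ?_ / _
      have h0 : (0 : ℝ) ≤ m * β := by positivity
      nlinarith
    · split_ifs
      · refine le_max_of_le_right ?_
        have := hu (n + 1) (by omega) (by omega) ((α + β) / (n + 1)) (β / (n + 1))
          (by positivity) (by rw [← mul_div_assoc]; gcongr; linarith)
        refine le_trans (le_of_eq ?_) this
        ring
      · exact le_max_left _ _

theorem vApprox_eq_stepReward (N n m : ℕ) :
    vApprox N n m = stepReward N (threshold N (m + 1)) (fun k => vApprox N k (m + 1)) n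
      (m / (m + 1)) (1 / (m + 1)) := by
  rw [vApprox, stepReward]
  have hm : (m : ℝ) + 1 ≠ 0 := by positivity
  have hacc : ∀ k : ℕ, (m : ℝ) / (m + 1) * n / (N * ((k : ℝ) - 1))
      + 1 / ((m : ℝ) + 1) * n * ((n : ℝ) - 1) / (N * ((k : ℝ) - 1) * ((k : ℝ) - 2))
      = (m : ℝ) * n / (((m : ℝ) + 1) * N * ((k : ℝ) - 1))
        + (n : ℝ) * ((n : ℝ) - 1) / (((m : ℝ) + 1) * N * ((k : ℝ) - 1) * ((k : ℝ) - 2)) := by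
    intro k
    simp only [div_eq_mul_inv, mul_inv]
    ring
  split_ifs with h
  · rw [wApprox, Finset.mul_sum, Finset.mul_sum, ← Finset.sum_add_distrib]
    refine Finset.sum_congr rfl fun k hk => ?_
    rw [if_neg (by have := (Finset.mem_Icc.1 hk).1; omega)]
    simp only [div_eq_mul_inv, mul_inv]
    ring
  · rw [Finset.sum_ite]
    congr 1
    · rw [Finset.sum_attach ((Finset.Icc (n + 1) N).filter fun k => k < threshold N (m + 1))
        (fun k : ℕ => ((m : ℝ) * n / (((m : ℝ) + 1) * (k : ℝ) * ((k : ℝ) - 1))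
        + 2 * (n : ℝ) * ((n : ℝ) - 1)
            / (((m : ℝ) + 1) * (k : ℝ) * ((k : ℝ) - 1) * ((k : ℝ) - 2)))
        * vApprox N k (m + 1))]
      refine Finset.sum_congr rfl fun k _ => ?_
      congr 1
      simp only [div_eq_mul_inv, mul_inv]
      ring
    · refine Finset.sum_congr ?_ fun k _ => (hacc k).symm
      ext k
      simp only [Finset.mem_Icc, Finset.mem_filter]
      omega

theorem vApprox_mul_le_gameValue {N : ℕ} (n : ℕ) : 2 ≤ n → ∀ (m : ℕ) {α β : ℝ}, 0 ≤ β →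
    m * β ≤ α → vApprox N n m * (α + β) ≤ gameValue N n 0 α β := by
  suffices H : ∀ l n, N - n = l → 2 ≤ n → ∀ (m : ℕ) {α β : ℝ}, 0 ≤ β →
      m * β ≤ α → vApprox N n m * (α + β) ≤ gameValue N n 0 α β from H _ n rfl
  intro l
  induction l using Nat.strong_induction_on with
  | _ l ih =>
    intro n hl hn m α β hβ hα
    have hm : (0 : ℝ) < (m : ℝ) + 1 := by positivity
    have h0 : 0 ≤ m * β := by positivity
    have h1 : vApprox N n m ≤ gameValue N n 0 (m / (m + 1)) (1 / (m + 1)) := by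
      rw [vApprox_eq_stepReward]
      refine stepReward_le_gameValue (m := m) n hn ?_ (by positivity) (by rw [mul_one_div])
      intro k hk hkN α β hβ hα
      exact ih (N - k) (by omega) k rfl (by omega) (m + 1) hβ (by push_cast; exact hα)
    calc vApprox N n m * (α + β)
        ≤ (α + β) * gameValue N n 0 (m / (m + 1)) (1 / (m + 1)) := by
          rw [mul_comm]; exact mul_le_mul_of_nonneg_left h1 (by linarith)
      _ = gameValue N n 0 ((α + β) * (m / (m + 1))) ((α + β) * (1 / (m + 1))) := by
          rw [← gameValue_smul N n (by linarith), mul_zero]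
      _ ≤ gameValue N n 0 α β := by
          have hαβ : 0 ≤ α + β := by linarith
          refine gameValue_mono N n (by omega) (by positivity) hβ ?_ ?_
          · rw [← mul_div_assoc, div_le_iff₀ hm]
            nlinarith
          · field_simp

theorem sum_div_le_gameValue {N : ℕ} (n : ℕ) : 1 ≤ n →
    ∑ k ∈ Finset.Icc (n + 1) N, (n : ℝ) * vApprox N k 0 / ((k : ℝ) * ((k : ℝ) - 1))
      ≤ gameValue N n 1 0 0 := by
  induction n using downward_induction (N := N) with
  | hbase n h =>
    intros
    rw [gameValue_of_le h, Finset.Icc_eq_empty (by omega), Finset.sum_empty]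
  | hstep n h ih =>
    intro hn
    have hn' : (1 : ℝ) ≤ n := by exact_mod_cast hn
    rw [← Finset.insert_Icc_add_one_left_eq_Icc (by omega : n + 1 ≤ N),
      Finset.sum_insert (by simp)]
    have h1 := ih (by omega)
    have h2 : vApprox N (n + 1) 0 ≤ gameValue N (n + 1) 0 0 1 := by
      simpa using vApprox_mul_le_gameValue (N := N) (n + 1) (by omega) 0 (α := 0) (β := 1)
        (by norm_num) (by norm_num)
    have hp : 0 ≤ (n : ℝ) / (n + 1) := by positivity
    have hq : 0 ≤ 1 / ((n : ℝ) + 1) := by positivity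
    have h3 := gameValue_smul N (n + 1) hp 1 0 0
    have h4 := gameValue_smul N (n + 1) hq 0 0 1
    have h5 := gameValue_add_of_zero N (n + 1) (by omega) hp hq
    simp only [mul_zero, mul_one] at h3 h4
    have hz : gameValue N (n + 1) 0 0 0 = 0 := by
      simpa using gameValue_smul N (n + 1) (le_refl 0) 0 0 0
    rw [gameValue_of_lt h]
    simp only [mul_zero, mul_one, zero_div, zero_add, add_zero, hz, max_self]
    have e : ∑ k ∈ Finset.Icc (n + 1 + 1) N, (n : ℝ) * vApprox N k 0 / ((k : ℝ) * ((k : ℝ) - 1))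
        = n / (n + 1) * ∑ k ∈ Finset.Icc (n + 1 + 1) N,
          ((n + 1 : ℕ) : ℝ) * vApprox N k 0 / ((k : ℝ) * ((k : ℝ) - 1)) := by
      rw [Finset.mul_sum]
      refine Finset.sum_congr rfl fun k _ => ?_
      push_cast
      field_simp
    have e2 : (n : ℝ) * vApprox N (n + 1) 0 / (((n + 1 : ℕ) : ℝ) * (((n + 1 : ℕ) : ℝ) - 1))
        = 1 / (n + 1) * vApprox N (n + 1) 0 := by
      push_cast
      rw [add_sub_cancel_right]
      field_simp
    rw [e, e2]
    have := mul_le_mul_of_nonneg_left h1 hp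
    have := mul_le_mul_of_nonneg_left h2 hq
    linarith

variable {N : ℕ}

/-! ## Independence and uniformity of the relative ranks -/

/-- `ω` and `ω'` put the first `n` objects into the same order. -/
def SameOrder (n : ℕ) (ω ω' : Equiv.Perm (Fin N)) : Prop :=
  ∀ i j : Fin N, (i : ℕ) < n → (j : ℕ) < n → (ω i ≤ ω j ↔ ω' i ≤ ω' j)

/-- The event `E` is determined by the order of the first `n` objects. -/
def DeterminedBy (n : ℕ) (E : Set (Equiv.Perm (Fin N))) : Prop :=
  ∀ ω ω', SameOrder n ω ω' → ω ∈ E → ω' ∈ E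

theorem SameOrder.symm {n : ℕ} {ω ω' : Equiv.Perm (Fin N)} (h : SameOrder n ω ω') :
    SameOrder n ω' ω := fun i j hi hj => (h i j hi hj).symm

theorem SameOrder.mono {n l : ℕ} (hnl : n ≤ l) {ω ω' : Equiv.Perm (Fin N)}
    (h : SameOrder l ω ω') : SameOrder n ω ω' :=
  fun i j hi hj => h i j (by omega) (by omega)

theorem DeterminedBy.mono {n l : ℕ} (hnl : n ≤ l) {E : Set (Equiv.Perm (Fin N))}
    (h : DeterminedBy n E) : DeterminedBy l E :=
  fun ω ω' hs => h ω ω' (hs.mono hnl)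

theorem DeterminedBy.inter {n : ℕ} {E F : Set (Equiv.Perm (Fin N))}
    (hE : DeterminedBy n E) (hF : DeterminedBy n F) : DeterminedBy n (E ∩ F) :=
  fun ω ω' hs h => ⟨hE ω ω' hs h.1, hF ω ω' hs h.2⟩

theorem DeterminedBy.diff {n : ℕ} {E F : Set (Equiv.Perm (Fin N))}
    (hE : DeterminedBy n E) (hF : DeterminedBy n F) : DeterminedBy n (E \ F) :=
  fun ω ω' hs h => ⟨hE ω ω' hs h.1, fun h' => h.2 (hF ω' ω hs.symm h')⟩

theorem determinedBy_setOf {n : ℕ} {p : Equiv.Perm (Fin N) → Prop}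
    (h : ∀ ω ω', SameOrder n ω ω' → (p ω ↔ p ω')) : DeterminedBy n {ω | p ω} :=
  fun ω ω' hs hp => (h ω ω' hs).1 hp

/-- The number of elements of an event, as a real number. -/
def cnt (E : Set (Equiv.Perm (Fin N))) : ℝ := (E.ncard : ℝ)

theorem cnt_nonneg (E : Set (Equiv.Perm (Fin N))) : 0 ≤ cnt E := Nat.cast_nonneg _

theorem cnt_mono {E F : Set (Equiv.Perm (Fin N))} (h : E ⊆ F) : cnt E ≤ cnt F :=
  Nat.cast_le.2 (Set.ncard_le_ncard h)

theorem cnt_empty : cnt (∅ : Set (Equiv.Perm (Fin N))) = 0 := by simp [cnt]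

theorem cnt_inter_add_diff (E F : Set (Equiv.Perm (Fin N))) :
    cnt (E ∩ F) + cnt (E \ F) = cnt E := by
  unfold cnt
  exact_mod_cast Set.ncard_inter_add_ncard_sdiff_eq_ncard E F

theorem cnt_union {E F : Set (Equiv.Perm (Fin N))} (h : Disjoint E F) :
    cnt (E ∪ F) = cnt E + cnt F := by
  unfold cnt
  exact_mod_cast Set.ncard_union_eq h

theorem cnt_pos {E : Set (Equiv.Perm (Fin N))} (h : E.Nonempty) : 0 < cnt E := by
  unfold cnt
  exact_mod_cast (Set.ncard_pos).2 h

theorem cnt_eq_sum_fiber {E : Set (Equiv.Perm (Fin N))} {f : Equiv.Perm (Fin N) → ℕ}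
    {s : Finset ℕ} (hf : ∀ ω, f ω ∈ s) : cnt E = ∑ r ∈ s, cnt (E ∩ {ω | f ω = r}) := by
  unfold cnt
  rw [Set.ncard_eq_toFinset_card', Finset.card_eq_sum_card_fiberwise (f := f) (t := s)
    (fun ω _ => hf ω), Nat.cast_sum]
  refine Finset.sum_congr rfl fun r _ => ?_
  rw [Set.ncard_eq_toFinset_card']
  congr 2
  ext ω
  simp

theorem card_filter_le_orderEmbOfFin (V : Finset (Fin N)) {c : ℕ} (hc : V.card = c)
    (s : Fin c) :
    (V.filter (fun x => x ≤ V.orderEmbOfFin hc s)).card = (s : ℕ) + 1 := by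
  have : V.filter (fun x => x ≤ V.orderEmbOfFin hc s)
      = (Finset.Iic s).map (V.orderEmbOfFin hc).toEmbedding := by
    ext x
    simp only [Finset.mem_filter, Finset.mem_map, Finset.mem_Iic, RelEmbedding.coe_toEmbedding]
    constructor
    · rintro ⟨hx, hxs⟩
      rw [← Finset.mem_coe, ← Finset.range_orderEmbOfFin V hc] at hx
      obtain ⟨y, rfl⟩ := hx
      exact ⟨y, (OrderEmbedding.le_iff_le _).1 hxs, rfl⟩
    · rintro ⟨y, hy, rfl⟩
      exact ⟨Finset.orderEmbOfFin_mem _ _ _, (OrderEmbedding.le_iff_le _).2 hy⟩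
  rw [this, Finset.card_map, Fin.card_Iic]

/-- The absolute ranks of the objects up to `k`. -/
def prefixValues (k : Fin N) (ω : Equiv.Perm (Fin N)) : Finset (Fin N) :=
  (Finset.Iic k).map ω.toEmbedding

theorem card_prefixValues (k : Fin N) (ω : Equiv.Perm (Fin N)) :
    (prefixValues k ω).card = (k : ℕ) + 1 := by
  rw [prefixValues, Finset.card_map, Fin.card_Iic]

theorem mem_prefixValues {k i : Fin N} {ω : Equiv.Perm (Fin N)} :
    ω i ∈ prefixValues k ω ↔ i ≤ k := by
  simp [prefixValues]

theorem relRank_eq_card_prefixValues (k : Fin N) (ω : Equiv.Perm (Fin N)) :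
    relRank ω k = ((prefixValues k ω).filter (fun x => x ≤ ω k)).card := by
  rw [relRank, ← Finset.card_map ω.toEmbedding]
  congr 1
  ext x
  obtain ⟨i, rfl⟩ := ω.surjective x
  simp [prefixValues]

/-- The `s`-th smallest of the absolute ranks of the objects up to `k`, counting from `0`. -/
def nthValue (k : Fin N) (s : ℕ) (hs : s ≤ k) (ω : Equiv.Perm (Fin N)) : Fin N :=
  (prefixValues k ω).orderEmbOfFin (card_prefixValues k ω) ⟨s, by omega⟩

theorem relRank_eq_iff (k : Fin N) (s : ℕ) (hs : s ≤ k) (ω : Equiv.Perm (Fin N)) :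
    relRank ω k = s + 1 ↔ ω k = nthValue k s hs ω := by
  have hk : ω k ∈ prefixValues k ω := mem_prefixValues.2 le_rfl
  rw [← Finset.mem_coe, ← Finset.range_orderEmbOfFin (prefixValues k ω) (card_prefixValues k ω)] at hk
  obtain ⟨y, hy⟩ := hk
  rw [relRank_eq_card_prefixValues, ← hy, card_filter_le_orderEmbOfFin, nthValue]
  refine Iff.trans ?_ (OrderEmbedding.eq_iff_eq _).symm
  rw [Fin.ext_iff]
  simp

theorem nthValue_mem (k : Fin N) (s : ℕ) (hs : s ≤ k) (ω : Equiv.Perm (Fin N)) :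
    nthValue k s hs ω ∈ prefixValues k ω := Finset.orderEmbOfFin_mem _ _ _

theorem nthValue_lt (k : Fin N) (s : ℕ) (hs : s + 1 ≤ k) (ω : Equiv.Perm (Fin N)) :
    nthValue k s (by omega) ω < nthValue k (s + 1) hs ω :=
  (OrderEmbedding.lt_iff_lt _).2 (Fin.mk_lt_mk.2 (Nat.lt_succ_self s))

theorem le_nthValue_iff (k : Fin N) (s : ℕ) (hs : s + 1 ≤ k) (ω : Equiv.Perm (Fin N))
    {x : Fin N} (hx : x ∈ prefixValues k ω) :
    x < nthValue k (s + 1) hs ω ↔ x ≤ nthValue k s (by omega) ω := by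
  rw [← Finset.mem_coe, ← Finset.range_orderEmbOfFin (prefixValues k ω) (card_prefixValues k ω)] at hx
  obtain ⟨y, rfl⟩ := hx
  rw [nthValue, nthValue, OrderEmbedding.lt_iff_lt, OrderEmbedding.le_iff_le, Fin.lt_def,
    Fin.le_def]
  exact Nat.lt_succ_iff

/-- Exchange the absolute ranks that are `s`-th and `(s+1)`-st among those of the objects up
to `k`. -/
def exchange (k : Fin N) (s : ℕ) (hs : s + 1 ≤ k) (ω : Equiv.Perm (Fin N)) :
    Equiv.Perm (Fin N) :=
  Equiv.swap (nthValue k s (by omega) ω) (nthValue k (s + 1) hs ω) * ω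

theorem prefixValues_exchange (k : Fin N) (s : ℕ) (hs : s + 1 ≤ k) (ω : Equiv.Perm (Fin N)) :
    prefixValues k (exchange k s hs ω) = prefixValues k ω := by
  symm
  refine Finset.eq_of_subset_of_card_le ?_ (by simp [card_prefixValues])
  intro x hx
  have h1 := nthValue_mem k s (by omega) ω
  have h2 := nthValue_mem k (s + 1) hs ω
  obtain ⟨y, hy⟩ : ∃ y, y ∈ prefixValues k ω ∧
      Equiv.swap (nthValue k s (by omega) ω) (nthValue k (s + 1) hs ω) y = x := by
    refine ⟨Equiv.swap (nthValue k s (by omega) ω) (nthValue k (s + 1) hs ω) x, ?_, by simp⟩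
    rw [Equiv.swap_apply_def]
    split_ifs <;> assumption
  obtain ⟨i, rfl⟩ := ω.surjective y
  have : exchange k s hs ω i = x := hy.2
  rw [← this, mem_prefixValues]
  exact mem_prefixValues.1 hy.1

theorem nthValue_exchange (k : Fin N) (s : ℕ) (hs : s + 1 ≤ k) (r : ℕ) (hr : r ≤ k)
    (ω : Equiv.Perm (Fin N)) : nthValue k r hr (exchange k s hs ω) = nthValue k r hr ω := by
  simp only [nthValue, prefixValues_exchange]

theorem exchange_exchange (k : Fin N) (s : ℕ) (hs : s + 1 ≤ k) (ω : Equiv.Perm (Fin N)) :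
    exchange k s hs (exchange k s hs ω) = ω := by
  rw [exchange, nthValue_exchange, nthValue_exchange, exchange, Equiv.swap_mul_self_mul]

theorem exchange_apply_of_eq (k : Fin N) (s : ℕ) (hs : s + 1 ≤ k) {ω : Equiv.Perm (Fin N)}
    (h : relRank ω k = s + 1) : relRank (exchange k s hs ω) k = s + 1 + 1 := by
  rw [relRank_eq_iff k s (by omega)] at h
  rw [relRank_eq_iff k (s + 1) hs, nthValue_exchange, exchange, Equiv.Perm.mul_apply, h,
    Equiv.swap_apply_left]

theorem exchange_apply_of_eq' (k : Fin N) (s : ℕ) (hs : s + 1 ≤ k) {ω : Equiv.Perm (Fin N)}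
    (h : relRank ω k = s + 1 + 1) : relRank (exchange k s hs ω) k = s + 1 := by
  rw [relRank_eq_iff k (s + 1) hs] at h
  rw [relRank_eq_iff k s (by omega), nthValue_exchange, exchange, Equiv.Perm.mul_apply, h,
    Equiv.swap_apply_right]

theorem sameOrder_exchange (k : Fin N) (s : ℕ) (hs : s + 1 ≤ k) {ω : Equiv.Perm (Fin N)}
    (h : relRank ω k = s + 1) : SameOrder k ω (exchange k s hs ω) := by
  rw [relRank_eq_iff k s (by omega)] at h
  have hlt := nthValue_lt k s hs ω
  intro i j hi hj
  have key : ∀ i : Fin N, (i : ℕ) < k → ω i ∈ prefixValues k ω ∧ ω i ≠ nthValue k s (by omega) ω := by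
    intro i hi
    refine ⟨mem_prefixValues.2 (Fin.le_def.2 hi.le), fun h' => ?_⟩
    rw [← h] at h'
    have := ω.injective h'
    omega
  obtain ⟨hi1, hi2⟩ := key i hi
  obtain ⟨hj1, hj2⟩ := key j hj
  have hi3 := le_nthValue_iff k s hs ω hi1
  have hj3 := le_nthValue_iff k s hs ω hj1
  rw [exchange, Equiv.Perm.mul_apply, Equiv.Perm.mul_apply]
  generalize nthValue k s (by omega) ω = a at *
  generalize nthValue k (s + 1) hs ω = b at *
  rw [Equiv.swap_apply_def, Equiv.swap_apply_def, if_neg hi2, if_neg hj2]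
  split_ifs with h1 h2 h2
  · simp [h1, h2]
  · rw [h1, ← not_lt, ← not_lt, hj3]
    constructor
    · intro h' h''
      exact h' h''.le
    · intro h' h''
      exact h' (lt_of_le_of_ne h'' hj2)
  · rw [h2, ← hi3]
    exact (lt_iff_le_and_ne.trans (and_iff_left h1)).symm
  · rfl

theorem cnt_relRank_succ {k : Fin N} {E : Set (Equiv.Perm (Fin N))} (hE : DeterminedBy k E)
    (s : ℕ) (hs : s + 1 ≤ k) :
    cnt (E ∩ {ω | relRank ω k = s + 1}) = cnt (E ∩ {ω | relRank ω k = s + 1 + 1}) := by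
  have hinj : Function.Injective (exchange k s hs) :=
    Function.LeftInverse.injective (exchange_exchange k s hs)
  unfold cnt
  rw [← Set.ncard_image_of_injective _ hinj]
  congr 2
  ext ω
  constructor
  · rintro ⟨ω, ⟨h1, h2⟩, rfl⟩
    exact ⟨hE _ _ (sameOrder_exchange k s hs h2) h1, exchange_apply_of_eq k s hs h2⟩
  · rintro ⟨h1, h2⟩
    have h3 := exchange_apply_of_eq' k s hs h2
    have h4 := sameOrder_exchange k s hs h3
    rw [exchange_exchange] at h4
    exact ⟨exchange k s hs ω, ⟨hE _ _ h4.symm h1, h3⟩, exchange_exchange k s hs ω⟩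

theorem relRank_pos (ω : Equiv.Perm (Fin N)) (k : Fin N) : 1 ≤ relRank ω k :=
  Finset.card_pos.2 ⟨k, by simp⟩

theorem relRank_le (ω : Equiv.Perm (Fin N)) (k : Fin N) : relRank ω k ≤ k + 1 := by
  rw [relRank_eq_card_prefixValues, ← card_prefixValues k ω]
  exact Finset.card_filter_le _ _

/-- The relative rank of object `k` is uniform and independent of the order of the previous
objects. -/
theorem cnt_relRank {k : Fin N} {E : Set (Equiv.Perm (Fin N))} (hE : DeterminedBy k E)
    {r : ℕ} (hr : 1 ≤ r) (hrk : r ≤ k + 1) :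
    cnt (E ∩ {ω | relRank ω k = r}) = cnt E / ((k : ℕ) + 1) := by
  have hconst : ∀ s : ℕ, s ≤ k →
      cnt (E ∩ {ω | relRank ω k = s + 1}) = cnt (E ∩ {ω | relRank ω k = 0 + 1}) := by
    intro s
    induction s with
    | zero => intro; rfl
    | succ s ih => intro hs; rw [← cnt_relRank_succ hE s hs, ih (by omega)]
  have hsum := cnt_eq_sum_fiber (E := E) (f := fun ω => relRank ω k)
    (s := Finset.Icc 1 (k + 1)) (fun ω => Finset.mem_Icc.2 ⟨relRank_pos ω k, relRank_le ω k⟩)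
  have hall : ∀ r ∈ Finset.Icc 1 ((k : ℕ) + 1),
      cnt (E ∩ {ω | relRank ω k = r}) = cnt (E ∩ {ω | relRank ω k = 0 + 1}) := by
    intro r hr
    obtain ⟨s, rfl⟩ : ∃ s, r = s + 1 := ⟨r - 1, by have := Finset.mem_Icc.1 hr; omega⟩
    exact hconst s (by have := Finset.mem_Icc.1 hr; omega)
  rw [Finset.sum_congr rfl hall, Finset.sum_const, Nat.card_Icc, nsmul_eq_mul] at hsum
  rw [hall r (Finset.mem_Icc.2 ⟨hr, hrk⟩), hsum]
  push_cast
  have : ((k : ℕ) : ℝ) + 1 ≠ 0 := by positivity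
  field_simp

/-- The relative rank is also uniform at a value that depends on the previous objects. -/
theorem cnt_relRank_eq {k : Fin N} {E : Set (Equiv.Perm (Fin N))} (hE : DeterminedBy k E)
    {r : Equiv.Perm (Fin N) → ℕ} (hr : ∀ ω, 1 ≤ r ω ∧ r ω ≤ k + 1)
    (hrd : ∀ ω ω', SameOrder k ω ω' → r ω = r ω') :
    cnt (E ∩ {ω | relRank ω k = r ω}) = cnt E / ((k : ℕ) + 1) := by
  have hmem : ∀ ω, r ω ∈ Finset.Icc 1 ((k : ℕ) + 1) := fun ω => Finset.mem_Icc.2 (hr ω)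
  rw [cnt_eq_sum_fiber hmem, cnt_eq_sum_fiber (E := E) hmem, Finset.sum_div]
  refine Finset.sum_congr rfl fun c hc => ?_
  have := Finset.mem_Icc.1 hc
  have hd : DeterminedBy k (E ∩ {ω | r ω = c}) :=
    hE.inter (determinedBy_setOf fun ω ω' h => by rw [hrd ω ω' h])
  rw [← cnt_relRank hd this.1 this.2]
  congr 1
  ext ω
  simp only [Set.mem_inter_iff, Set.mem_ofPred_eq]
  constructor
  · rintro ⟨⟨h1, h2⟩, h3⟩
    exact ⟨⟨h1, h3⟩, h2.trans h3⟩
  · rintro ⟨⟨h1, h3⟩, h2⟩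
    exact ⟨⟨h1, h2.trans h3.symm⟩, h3⟩

theorem cnt_relRank_ne {k : Fin N} {E : Set (Equiv.Perm (Fin N))} (hE : DeterminedBy k E) :
    cnt (E ∩ {ω | relRank ω k ≠ 1}) = k * cnt E / ((k : ℕ) + 1) := by
  have h := cnt_inter_add_diff E {ω | relRank ω k = 1}
  have h2 : E \ {ω | relRank ω k = 1} = E ∩ {ω | relRank ω k ≠ 1} := by
    ext ω; simp
  rw [cnt_relRank hE le_rfl (by omega), h2] at h
  have : ((k : ℕ) : ℝ) + 1 ≠ 0 := by positivity
  field_simp at h ⊢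
  linarith

theorem cnt_relRank_ne_ne {k : Fin N} (hk : 1 ≤ (k : ℕ)) {E : Set (Equiv.Perm (Fin N))}
    (hE : DeterminedBy k E) :
    cnt (E ∩ {ω | relRank ω k ≠ 1 ∧ relRank ω k ≠ 2}) = (k - 1) * cnt E / ((k : ℕ) + 1) := by
  have h := cnt_inter_add_diff (E ∩ {ω | relRank ω k ≠ 1}) {ω | relRank ω k = 2}
  have h2 : (E ∩ {ω | relRank ω k ≠ 1}) \ {ω | relRank ω k = 2}
      = E ∩ {ω | relRank ω k ≠ 1 ∧ relRank ω k ≠ 2} := by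
    ext ω; simp; tauto
  have h3 : (E ∩ {ω | relRank ω k ≠ 1}) ∩ {ω | relRank ω k = 2}
      = E ∩ {ω | relRank ω k = 2} := by
    ext ω; simp; omega
  rw [h2, h3, cnt_relRank_ne hE, cnt_relRank hE (by omega) (by omega)] at h
  have : ((k : ℕ) : ℝ) + 1 ≠ 0 := by positivity
  field_simp at h ⊢
  linarith

theorem relRank_eq_one_iff {ω : Equiv.Perm (Fin N)} {k : Fin N} :
    relRank ω k = 1 ↔ ∀ j, j ≤ k → ω k ≤ ω j := by
  rw [relRank, Finset.card_eq_one]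
  constructor
  · rintro ⟨a, ha⟩ j hj
    have hk : k ∈ Finset.univ.filter (fun j : Fin N => j ≤ k ∧ ω j ≤ ω k) := by simp
    rw [ha, Finset.mem_singleton] at hk
    by_contra hlt
    have hj' : j ∈ Finset.univ.filter (fun j : Fin N => j ≤ k ∧ ω j ≤ ω k) := by
      simp [hj, (not_le.1 hlt).le]
    rw [ha, Finset.mem_singleton] at hj'
    subst hk hj'
    exact hlt le_rfl
  · intro h
    refine ⟨k, ?_⟩
    ext j
    simp only [Finset.mem_filter, Finset.mem_univ, true_and, Finset.mem_singleton]
    constructor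
    · rintro ⟨h1, h2⟩
      exact ω.injective (le_antisymm h2 (h j h1))
    · rintro rfl
      exact ⟨le_rfl, le_rfl⟩

/-- The best of the first `l` objects is the best of all with probability `l / N`. -/
theorem cnt_best {k : Fin N} (l : ℕ) : (k : ℕ) < l → l ≤ N →
    ∀ {E : Set (Equiv.Perm (Fin N))}, DeterminedBy l E →
    (∀ ω ∈ E, ∀ j : Fin N, (j : ℕ) < l → ω k ≤ ω j) →
    cnt (E ∩ {ω | (ω k : ℕ) = 0}) = l * cnt E / N := by
  have hN : (0 : ℝ) < N := by exact_mod_cast (Nat.zero_le _).trans_lt k.2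
  induction l using downward_induction (N := N) with
  | hbase l h =>
    intro hk hl E hE hbest
    obtain rfl : l = N := by omega
    have : E ∩ {ω | (ω k : ℕ) = 0} = E := by
      refine Set.inter_eq_left.2 fun ω hω => ?_
      have := hbest ω hω (ω.symm ⟨0, by omega⟩) (Fin.is_lt _)
      rw [Equiv.apply_symm_apply, Fin.le_def] at this
      simpa using this
    rw [this]
    field_simp
  | hstep l h ih =>
    intro hk hl E hE hbest
    have hE' : DeterminedBy ((⟨l, h⟩ : Fin N) : ℕ) E := hE
    have hd : DeterminedBy (l + 1) {ω : Equiv.Perm (Fin N) | relRank ω ⟨l, h⟩ ≠ 1} := by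
      refine determinedBy_setOf fun ω ω' hs => ?_
      rw [ne_eq, ne_eq, relRank_eq_one_iff, relRank_eq_one_iff]
      refine not_congr (forall_congr' fun j => ?_)
      refine imp_congr_right fun hj => hs _ _ (Nat.lt_succ_self l) ?_
      exact Nat.lt_succ_iff.2 hj
    have h1 := ih (by omega) (by omega)
      (E := E ∩ {ω | relRank ω ⟨l, h⟩ ≠ 1}) ((hE.mono (by omega)).inter hd) (by
        rintro ω ⟨hω, hr⟩ j hj
        rcases Nat.lt_succ_iff_lt_or_eq.1 hj with hj | hj
        · exact hbest ω hω j hj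
        · obtain rfl : j = ⟨l, h⟩ := Fin.ext hj
          by_contra hlt
          refine hr (relRank_eq_one_iff.2 fun i hi => ?_)
          rcases eq_or_lt_of_le hi with rfl | hi
          · exact le_rfl
          · exact (not_le.1 hlt).le.trans (hbest ω hω i hi))
    rw [cnt_relRank_ne hE'] at h1
    have h2 : E ∩ {ω | relRank ω ⟨l, h⟩ ≠ 1} ∩ {ω | (ω k : ℕ) = 0}
        = E ∩ {ω | (ω k : ℕ) = 0} := by
      ext ω
      simp only [Set.mem_inter_iff, Set.mem_ofPred_eq]
      refine ⟨fun h => ⟨h.1.1, h.2⟩, fun h' => ⟨⟨h'.1, fun hr => ?_⟩, h'.2⟩⟩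
      have h3 := relRank_eq_one_iff.1 hr k (Fin.le_def.2 hk.le)
      rw [Fin.le_def, h'.2, Nat.le_zero] at h3
      have : ω k = ω ⟨l, h⟩ := Fin.ext (by rw [h'.2, h3])
      have := congrArg Fin.val (ω.injective this)
      simp only at this
      omega
    rw [h2] at h1
    rw [h1]
    push_cast
    field_simp

/-! ## Player 1 and the observations of Player 2 -/

theorem nStar_le (N : ℕ) (hN : 1 ≤ N) : nStar N ≤ N :=
  Nat.sInf_le ⟨hN, by simp [S₁]⟩

theorem two_le_nStar {N : ℕ} (hN : 3 ≤ N) : 2 ≤ nStar N := by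
  have hmem : nStar N ∈ {n : ℕ | 1 ≤ n ∧ S₁ N n ≤ 1} :=
    Nat.sInf_mem ⟨N, by omega, by simp [S₁]⟩
  by_contra h
  have h1 : nStar N = 1 := by have := hmem.1; omega
  rw [h1] at hmem
  have h2 : ∑ k ∈ Finset.Icc (2 : ℕ) 3, 1 / ((k : ℝ) - 1) ≤ S₁ N 1 := by
    refine Finset.sum_le_sum_of_subset_of_nonneg (Finset.Icc_subset_Icc le_rfl hN) ?_
    intro k hk _
    have : (2 : ℝ) ≤ k := by exact_mod_cast (Finset.mem_Icc.1 hk).1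
    exact div_nonneg zero_le_one (by linarith)
  have h3 : ∑ k ∈ Finset.Icc (2 : ℕ) 3, 1 / ((k : ℝ) - 1) = 3 / 2 := by
    rw [show Finset.Icc (2 : ℕ) 3 = {2, 3} from rfl, Finset.sum_insert (by simp), Finset.sum_singleton]
    norm_num
  have := hmem.2
  linarith

/-- Player 1 has accepted one of the first `n` objects, and it is the best of them. -/
def TakenTop (ω : Equiv.Perm (Fin N)) (n : ℕ) : Prop :=
  ∃ t : Fin N, (t : ℕ) + 1 ≤ n ∧ IsTaken ω t ∧ ∀ j : Fin N, (j : ℕ) + 1 ≤ n → ω t ≤ ω j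

section Congr

variable {n : ℕ} {ω ω' : Equiv.Perm (Fin N)} (h : SameOrder n ω ω')
include h

theorem relRank_congr {i : Fin N} (hi : (i : ℕ) < n) : relRank ω i = relRank ω' i := by
  rw [relRank, relRank]
  congr 1
  refine Finset.filter_congr fun j _ => and_congr_right fun hj => ?_
  exact h j i (by omega) hi

theorem isTaken_congr {i : Fin N} (hi : (i : ℕ) < n) : IsTaken ω i ↔ IsTaken ω' i := by
  rw [IsTaken, IsTaken, relRank_congr h hi]
  refine and_congr_right fun _ => and_congr_right fun _ => forall_congr' fun j => ?_
  refine imp_congr_right fun hj => imp_congr_right fun _ => ?_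
  rw [relRank_congr h (by omega)]

theorem takenBy_congr {l : ℕ} (hl : l ≤ n) : TakenBy ω l ↔ TakenBy ω' l :=
  exists_congr fun _ => and_congr_right fun hi => isTaken_congr h (by omega)

theorem seenRank_congr {i : Fin N} (hi : (i : ℕ) < n) : seenRank ω i = seenRank ω' i := by
  rw [seenRank, seenRank]
  congr 1
  refine Finset.filter_congr fun j _ => and_congr_right fun hj => ?_
  rw [isTaken_congr h (by omega), h j i (by omega) hi]

theorem isCandidate_congr {i : Fin N} (hi : (i : ℕ) < n) :
    IsCandidate ω i ↔ IsCandidate ω' i := by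
  rw [IsCandidate, IsCandidate, isTaken_congr h hi, seenRank_congr h hi]

theorem candidateCount_congr {l : ℕ} (hl : l ≤ n) :
    candidateCount ω l = candidateCount ω' l := by
  rw [candidateCount, candidateCount]
  congr 1
  refine Finset.filter_congr fun j _ => and_congr_right fun _ => and_congr_right fun hj => ?_
  rw [isCandidate_congr h (by omega)]

theorem takenTop_congr {l : ℕ} (hl : l ≤ n) : TakenTop ω l ↔ TakenTop ω' l := by
  refine exists_congr fun t => and_congr_right fun ht => and_congr (isTaken_congr h (by omega)) ?_
  exact forall_congr' fun j => imp_congr_right fun hj => h t j (by omega) (by omega)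

theorem history_congr {l : ℕ} (hl : l ≤ n) : history ω l = history ω' l := by
  rw [history, history]
  have e : (List.finRange N).filter (fun i : Fin N => (i : ℕ) + 1 ≤ l ∧ ¬ IsTaken ω i)
      = (List.finRange N).filter (fun i : Fin N => (i : ℕ) + 1 ≤ l ∧ ¬ IsTaken ω' i) := by
    refine List.filter_congr fun i _ => ?_
    rw [decide_eq_decide]
    refine and_congr_right fun hi => ?_
    rw [isTaken_congr h (by omega)]
  rw [e]
  refine List.map_congr_left fun i hi => seenRank_congr h ?_
  rw [List.mem_filter, decide_eq_true_iff] at hi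
  omega

end Congr

theorem isTaken_unique {ω : Equiv.Perm (Fin N)} {i j : Fin N} (hi : IsTaken ω i)
    (hj : IsTaken ω j) : i = j := by
  rcases lt_trichotomy i j with h | h | h
  · exact absurd hi.2.1 (hj.2.2 i h hi.1)
  · exact h
  · exact absurd hj.2.1 (hi.2.2 j h hj.1)

theorem takenBy_succ {ω : Equiv.Perm (Fin N)} {k : Fin N} :
    TakenBy ω (k + 1) ↔ TakenBy ω k ∨ IsTaken ω k := by
  constructor
  · rintro ⟨i, hi, h⟩
    rcases Nat.lt_or_ge i k with hik | hik
    · exact Or.inl ⟨i, hik, h⟩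
    · obtain rfl : i = k := Fin.ext (by omega)
      exact Or.inr h
  · rintro (⟨i, hi, h⟩ | h)
    · exact ⟨i, by omega, h⟩
    · exact ⟨k, le_rfl, h⟩

theorem TakenTop.takenBy {ω : Equiv.Perm (Fin N)} {n : ℕ} (h : TakenTop ω n) : TakenBy ω n :=
  h.imp fun _ h => ⟨h.1, h.2.1⟩

theorem TakenBy.mono {ω : Equiv.Perm (Fin N)} {n l : ℕ} (h : TakenBy ω n) (hnl : n ≤ l) :
    TakenBy ω l := h.imp fun _ h => ⟨h.1.trans hnl, h.2⟩

theorem TakenBy.not_isTaken {ω : Equiv.Perm (Fin N)} {k : Fin N} (h : TakenBy ω k) :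
    ¬ IsTaken ω k := by
  obtain ⟨i, hi, h⟩ := h
  intro h'
  have := isTaken_unique h h'
  subst this
  omega

theorem isTaken_iff {ω : Equiv.Perm (Fin N)} {k : Fin N} (hk : nStar N ≤ k + 1)
    (h : ¬ TakenBy ω k) : IsTaken ω k ↔ relRank ω k = 1 := by
  refine ⟨fun h => h.2.1, fun hr => ⟨hk, hr, fun j hj hj1 hj2 => h ?_⟩⟩
  obtain ⟨i, hi, hmin⟩ := WellFounded.has_min (wellFounded_lt (α := Fin N))
    {i | nStar N ≤ i + 1 ∧ relRank ω i = 1} ⟨j, hj1, hj2⟩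
  have hij : i ≤ j := not_lt.1 (hmin j ⟨hj1, hj2⟩)
  exact ⟨i, by omega, hi.1, hi.2, fun l hl h1 h2 => hmin l ⟨h1, h2⟩ hl⟩

theorem seenRank_eq_one_iff {ω : Equiv.Perm (Fin N)} {k : Fin N} (hk : ¬ IsTaken ω k) :
    seenRank ω k = 1 ↔ ∀ j, j ≤ k → ¬ IsTaken ω j → ω k ≤ ω j := by
  rw [seenRank, Finset.card_eq_one]
  constructor
  · rintro ⟨a, ha⟩ j hj hj'
    have hk : k ∈ Finset.univ.filter
        (fun j : Fin N => j ≤ k ∧ ¬ IsTaken ω j ∧ ω j ≤ ω k) := by simp [hk]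
    rw [ha, Finset.mem_singleton] at hk
    by_contra hlt
    have hj' : j ∈ Finset.univ.filter
        (fun j : Fin N => j ≤ k ∧ ¬ IsTaken ω j ∧ ω j ≤ ω k) := by
      simp [hj, hj', (not_le.1 hlt).le]
    rw [ha, Finset.mem_singleton] at hj'
    subst hk hj'
    exact hlt le_rfl
  · intro h
    refine ⟨k, ?_⟩
    ext j
    simp only [Finset.mem_filter, Finset.mem_univ, true_and, Finset.mem_singleton]
    constructor
    · rintro ⟨h1, h2, h3⟩
      exact ω.injective (le_antisymm h3 (h j h1 h2))
    · rintro rfl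
      exact ⟨le_rfl, hk, le_rfl⟩

theorem relRank_eq_seenRank_add {ω : Equiv.Perm (Fin N)} {t k : Fin N} (ht : IsTaken ω t)
    (htk : t ≤ k) : relRank ω k = seenRank ω k + if ω t ≤ ω k then 1 else 0 := by
  rw [relRank, seenRank, ← Finset.card_filter_add_card_filter_not (fun j => ¬ IsTaken ω j)]
  rw [Finset.filter_filter, Finset.filter_filter]
  congr 1
  · congr 1
    refine Finset.filter_congr fun j _ => by tauto
  · have : Finset.univ.filter (fun j : Fin N => (j ≤ k ∧ ω j ≤ ω k) ∧ ¬ ¬ IsTaken ω j)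
        = if ω t ≤ ω k then {t} else ∅ := by
      ext j
      simp only [Finset.mem_filter, Finset.mem_univ, true_and, not_not]
      constructor
      · rintro ⟨⟨_, h2⟩, h3⟩
        obtain rfl := isTaken_unique h3 ht
        simp [h2]
      · split_ifs with h
        · intro hj
          obtain rfl := Finset.mem_singleton.1 hj
          exact ⟨⟨htk, h⟩, ht⟩
        · simp
    rw [this]
    split_ifs <;> simp

theorem takenTop_step {ω : Equiv.Perm (Fin N)} {k : Fin N} (h : TakenTop ω k) :
    (IsCandidate ω k ↔ relRank ω k = 1 ∨ relRank ω k = 2) ∧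
      (TakenTop ω (k + 1) ↔ relRank ω k ≠ 1) := by
  have hk := h.takenBy.not_isTaken
  obtain ⟨t, ht, ht1, ht2⟩ := h
  have htk : t ≤ k := Fin.le_def.2 (by omega)
  have hne : ω t ≠ ω k := fun h => by
    have := ω.injective h
    subst this
    omega
  have hr := relRank_eq_seenRank_add ht1 htk
  have hpos := relRank_pos ω k
  have hspos : 1 ≤ seenRank ω k := Finset.card_pos.2 ⟨k, by simp [hk]⟩
  have htop : TakenTop ω (k + 1) ↔ ω t ≤ ω k := by
    constructor
    · rintro ⟨t', _, h1, h2⟩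
      obtain rfl := isTaken_unique h1 ht1
      exact h2 k le_rfl
    · intro h
      refine ⟨t, by omega, ht1, fun j hj => ?_⟩
      rcases Nat.lt_or_ge j k with hjk | hjk
      · exact ht2 j hjk
      · obtain rfl : j = k := Fin.ext (by omega)
        exact h
  rw [IsCandidate, and_iff_right hk, htop]
  by_cases hlt : ω t ≤ ω k
  · rw [if_pos hlt] at hr
    simp only [hlt, true_iff]
    omega
  · rw [if_neg hlt] at hr
    have h1 : relRank ω k = 1 := by
      refine relRank_eq_one_iff.2 fun j hj => ?_
      rcases eq_or_lt_of_le hj with rfl | hj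
      · exact le_rfl
      · exact (not_le.1 hlt).le.trans (ht2 j hj)
    simp only [hlt, false_iff]
    omega

theorem takenBy_not_takenTop_step {ω : Equiv.Perm (Fin N)} {k : Fin N} (h : TakenBy ω k)
    (h' : ¬ TakenTop ω k) :
    (IsCandidate ω k ↔ relRank ω k = 1) ∧ ¬ TakenTop ω (k + 1) := by
  have hk := h.not_isTaken
  obtain ⟨t, ht, ht1⟩ := h
  have htk : t ≤ k := Fin.le_def.2 (by omega)
  obtain ⟨i, hi, hit⟩ : ∃ i : Fin N, (i : ℕ) + 1 ≤ k ∧ ω i < ω t := by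
    by_contra! hcon
    exact h' ⟨t, ht, ht1, hcon⟩
  have hiT : ¬ IsTaken ω i := fun h => by
    obtain rfl := isTaken_unique h ht1
    exact lt_irrefl _ hit
  refine ⟨?_, ?_⟩
  · rw [IsCandidate, and_iff_right hk, seenRank_eq_one_iff hk, relRank_eq_one_iff]
    refine ⟨fun hs j hj => ?_, fun hs j hj _ => hs j hj⟩
    by_cases hjT : IsTaken ω j
    · obtain rfl := isTaken_unique hjT ht1
      exact (hs i (Fin.le_def.2 (by omega)) hiT).trans hit.le
    · exact hs j hj hjT
  · rintro ⟨t', _, h1, h2⟩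
    obtain rfl := isTaken_unique h1 ht1
    exact absurd (h2 i (by omega)) (not_le.2 hit)

theorem not_takenBy_step {ω : Equiv.Perm (Fin N)} {k : Fin N} (hk : nStar N ≤ k + 1)
    (h : ¬ TakenBy ω k) :
    (TakenBy ω (k + 1) ↔ relRank ω k = 1) ∧ (TakenTop ω (k + 1) ↔ relRank ω k = 1) := by
  have h1 : TakenBy ω (k + 1) ↔ relRank ω k = 1 := by
    rw [takenBy_succ, isTaken_iff hk h, or_iff_right h]
  refine ⟨h1, fun h => h1.1 h.takenBy, fun hr => ⟨k, le_rfl, (isTaken_iff hk h).2 hr, ?_⟩⟩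
  intro j hj
  exact relRank_eq_one_iff.1 hr j (Fin.le_def.2 (by omega))

theorem seenRank_eq_relRank {ω : Equiv.Perm (Fin N)} {k : Fin N}
    (h : ¬ TakenBy ω (k + 1)) : seenRank ω k = relRank ω k := by
  rw [seenRank, relRank]
  congr 1
  refine Finset.filter_congr fun j _ => and_congr_right fun hj => and_iff_right fun hT => h ?_
  exact ⟨j, by omega, hT⟩

theorem history_eq_take (ω : Equiv.Perm (Fin N)) (n : ℕ) :
    history ω n = (((List.finRange N).take n).filter (fun i => ¬ IsTaken ω i)).map
      (seenRank ω) := by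
  rw [history]
  congr 1
  conv_lhs => rw [← List.take_append_drop n (List.finRange N)]
  rw [List.filter_append]
  have h1 : ∀ i ∈ (List.finRange N).take n, (i : ℕ) + 1 ≤ n := by
    intro i hi
    obtain ⟨l, hl, rfl⟩ := List.mem_iff_getElem.1 hi
    rw [List.length_take] at hl
    rw [List.getElem_take, List.getElem_finRange]
    simp only [Fin.val_cast]
    omega
  have h2 : ∀ i ∈ (List.finRange N).drop n, ¬ (i : ℕ) + 1 ≤ n := by
    intro i hi
    obtain ⟨l, hl, rfl⟩ := List.mem_iff_getElem.1 hi
    rw [List.getElem_drop, List.getElem_finRange]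
    simp only [Fin.val_cast]
    omega
  have h3 : ((List.finRange N).drop n).filter
      (fun i : Fin N => (i : ℕ) + 1 ≤ n ∧ ¬ IsTaken ω i) = [] := by
    refine List.filter_eq_nil_iff.2 fun i hi => ?_
    rw [decide_eq_true_iff]
    exact fun h => h2 i hi h.1
  rw [h3, List.append_nil]
  refine List.filter_congr fun i hi => ?_
  rw [decide_eq_decide]
  exact and_iff_right (h1 i hi)

theorem history_succ (ω : Equiv.Perm (Fin N)) (k : Fin N) :
    history ω (k + 1) = history ω k ++ if IsTaken ω k then [] else [seenRank ω k] := by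
  rw [history_eq_take, history_eq_take, List.take_add_one, List.filter_append, List.map_append]
  congr 1
  rw [List.getElem?_eq_getElem (by simp), List.getElem_finRange]
  by_cases h : IsTaken ω k <;> simp [h]

theorem history_prefix (ω : Equiv.Perm (Fin N)) {n l : ℕ} (h : n ≤ l) (hl : l ≤ N) :
    history ω n <+: history ω l := by
  induction l, h using Nat.le_induction with
  | base => exact List.prefix_rfl
  | succ l hnl ih =>
    refine (ih (by omega)).trans ?_
    have := history_succ ω ⟨l, by omega⟩
    simp only at this
    rw [this]
    exact List.prefix_append _ _

theorem length_history (ω : Equiv.Perm (Fin N)) {n : ℕ} (hn : n ≤ N) :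
    (history ω n).length + (if TakenBy ω n then 1 else 0) = n := by
  induction n with
  | zero =>
    rw [if_neg (by rintro ⟨i, hi, _⟩; omega), history_eq_take]
    simp
  | succ n ih =>
    have ih := ih (by omega)
    have h1 := history_succ ω ⟨n, hn⟩
    have h2 := takenBy_succ (ω := ω) (k := ⟨n, hn⟩)
    have h3 := TakenBy.not_isTaken (ω := ω) (k := ⟨n, hn⟩)
    simp only at h1 h2 h3
    rw [h1, List.length_append]
    simp only [h2]
    by_cases hT : TakenBy ω n
    · simp only [h3 hT, hT, if_true, if_false, or_false, List.length_singleton] at ih ⊢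
      omega
    · by_cases hk : IsTaken ω ⟨n, hn⟩
      · simp only [hk, hT, if_true, if_false, or_true, List.length_nil] at ih ⊢
        omega
      · simp only [hk, hT, if_false, or_false, List.length_singleton] at ih ⊢
        omega

theorem history_getElem? {ω : Equiv.Perm (Fin N)} {k : Fin N} (hk : ¬ IsTaken ω k) {n : ℕ}
    (hn : k + 1 ≤ n) (hnN : n ≤ N) :
    (history ω n)[(history ω k).length]? = some (seenRank ω k) := by
  have h1 := history_prefix ω hn hnN
  rw [history_succ, if_neg hk] at h1
  obtain ⟨t, ht⟩ := h1
  rw [← ht]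
  simp

theorem TakenBy.length_history {ω : Equiv.Perm (Fin N)} {n : ℕ} (h : TakenBy ω n) (hn : n ≤ N) :
    (history ω n).length = n - 1 := by
  have := StackelbergSecretary.length_history ω hn
  rw [if_pos h] at this
  omega

theorem length_history_of_not {ω : Equiv.Perm (Fin N)} {n : ℕ} (h : ¬ TakenBy ω n) (hn : n ≤ N) :
    (history ω n).length = n := by
  have := StackelbergSecretary.length_history ω hn
  rwa [if_neg h] at this

/-! ## Good strategies of Player 2, by backward induction -/

theorem winsAfter_iff {σ : Strategy} {ω : Equiv.Perm (Fin N)} {k : Fin N} :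
    WinsAfter k σ ω ↔
      (Wants σ ω k ∧ (ω k : ℕ) = 0) ∨ (¬ Wants σ ω k ∧ WinsAfter (k + 1) σ ω) := by
  constructor
  · rintro ⟨i, hi, hw, hfirst, h0⟩
    rcases Nat.lt_or_ge k i with hik | hik
    · refine Or.inr ⟨hfirst k (Nat.lt_succ_self _) hik, i, by omega, hw, fun j hj => ?_, h0⟩
      exact hfirst j (by omega)
    · obtain rfl : i = k := Fin.ext (by omega)
      exact Or.inl ⟨hw, h0⟩
  · rintro (⟨hw, h0⟩ | ⟨hw, i, hi, hwi, hfirst, h0⟩)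
    · exact ⟨k, Nat.lt_succ_self _, hw, fun j hj hjk => by omega, h0⟩
    · refine ⟨i, by omega, hwi, fun j hj hji => ?_, h0⟩
      rcases Nat.lt_or_ge k j with hkj | hkj
      · exact hfirst j (by omega) hji
      · obtain rfl : j = k := Fin.ext (by omega)
        exact hw

theorem winsAfter_congr {σ σ' : Strategy} {ω : Equiv.Perm (Fin N)} {n : ℕ}
    (h : ∀ i : Fin N, n < (i : ℕ) + 1 → (Wants σ ω i ↔ Wants σ' ω i)) :
    WinsAfter n σ ω ↔ WinsAfter n σ' ω := by
  refine exists_congr fun i => and_congr_right fun hi => and_congr (h i hi) (and_congr_left fun _ => ?_)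
  exact forall_congr' fun j => imp_congr_right fun hj => imp_congr_right fun _ => not_congr (h j hj)

/-- Follow `σ₁` if the observation number `p` (counted from `0`) has rank 1, and `σ₂` otherwise,
except that at the moment when exactly `l` objects have been observed an object is accepted if and
only if `acc` holds and the observation number `p` has rank 1. -/
def patch (acc : Prop) (p l : ℕ) (σ₁ σ₂ : Strategy) : Strategy := fun L =>
  if L.length = l then decide (acc ∧ L[p]? = some 1) else if L[p]? = some 1 then σ₁ L else σ₂ L

theorem patch_of_length {acc : Prop} {p l : ℕ} {σ₁ σ₂ : Strategy} {L : List ℕ}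
    (h : L.length = l) : patch acc p l σ₁ σ₂ L = true ↔ acc ∧ L[p]? = some 1 := by
  rw [patch, if_pos h, decide_eq_true_iff]

theorem patch_of_eq {acc : Prop} {p l : ℕ} {σ₁ σ₂ : Strategy} {L : List ℕ}
    (h : L.length ≠ l) (h' : L[p]? = some 1) : patch acc p l σ₁ σ₂ L = σ₁ L := by
  rw [patch, if_neg h, if_pos h']

theorem patch_of_ne {acc : Prop} {p l : ℕ} {σ₁ σ₂ : Strategy} {L : List ℕ}
    (h : L.length ≠ l) (h' : L[p]? ≠ some 1) : patch acc p l σ₁ σ₂ L = σ₂ L := by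
  rw [patch, if_neg h, if_neg h']

theorem history_getElem?_of_takenBy {ω : Equiv.Perm (Fin N)} {k : Fin N} (h : TakenBy ω k)
    {n : ℕ} (hn : k + 1 ≤ n) (hnN : n ≤ N) :
    (history ω n)[(k : ℕ) - 1]? = some (seenRank ω k) := by
  rw [← history_getElem? h.not_isTaken hn hnN, h.length_history (by omega)]

theorem history_getElem?_of_not {ω : Equiv.Perm (Fin N)} {k : Fin N} (h : ¬ TakenBy ω (k + 1))
    {n : ℕ} (hn : k + 1 ≤ n) (hnN : n ≤ N) :
    (history ω n)[(k : ℕ)]? = some (relRank ω k) := by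
  rw [takenBy_succ, not_or] at h
  rw [← seenRank_eq_relRank (by rwa [takenBy_succ, not_or]), ← history_getElem? h.2 hn hnN,
    length_history_of_not h.1 (by omega)]

theorem TakenBy.nStar_le {ω : Equiv.Perm (Fin N)} {n : ℕ} (h : TakenBy ω n) : nStar N ≤ n := by
  obtain ⟨i, hi, h⟩ := h
  exact h.1.trans hi

/-- In a position in which Player 1 may already accept objects, a candidate at the next moment is
recognized by Player 2 from the ranks that he observes. -/
theorem exists_patch {k : Fin N} (hk : nStar N ≤ k + 1) (acc : Prop)
    {σ₁ σ₂ : Strategy} (h₁ : ∀ L, σ₁ L = true → L.getLast? = some 1)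
    (h₂ : ∀ L, σ₂ L = true → L.getLast? = some 1) :
    ∃ σ : Strategy, (∀ L, σ L = true → L.getLast? = some 1) ∧
      ∀ ω : Equiv.Perm (Fin N),
        (TakenBy ω k → IsCandidate ω k →
          (WinsAfter k σ ω ↔ if acc then (ω k : ℕ) = 0 else WinsAfter (k + 1) σ₁ ω)) ∧
        (¬ (TakenBy ω k ∧ IsCandidate ω k) → (WinsAfter k σ ω ↔ WinsAfter (k + 1) σ₂ ω)) := by
  have hnot : ∀ ω : Equiv.Perm (Fin N), ¬ TakenBy ω k →
      ¬ Wants σ₂ ω k := by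
    rintro ω hT ⟨hw, hσ⟩
    have hT' : ¬ TakenBy ω (k + 1) := by rw [takenBy_succ]; tauto
    have := h₂ _ hσ
    rw [List.getLast?_eq_getElem?, length_history_of_not hT' (by omega), Nat.add_sub_cancel,
      history_getElem?_of_not hT' le_rfl (by omega), Option.some_inj] at this
    exact hw ((isTaken_iff hk hT).2 this)
  by_cases hk' : nStar N ≤ k
  swap
  · have hT : ∀ ω : Equiv.Perm (Fin N), ¬ TakenBy ω k := fun ω hT => hk' hT.nStar_le
    refine ⟨σ₂, h₂, fun ω => ⟨fun h => absurd h (hT ω), fun _ => ?_⟩⟩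
    rw [winsAfter_iff]
    simp [hnot ω (hT ω)]
  refine ⟨patch acc (k - 1) k σ₁ σ₂, fun L hL => ?_, fun ω => ⟨fun hT hC => ?_, fun hTC => ?_⟩⟩
  · by_cases hl : L.length = k
    · rw [patch_of_length hl] at hL
      rw [List.getLast?_eq_getElem?, hl]
      exact hL.2
    · by_cases hp : L[(k : ℕ) - 1]? = some 1
      · rw [patch_of_eq hl hp] at hL
        exact h₁ L hL
      · rw [patch_of_ne hl hp] at hL
        exact h₂ L hL
  · have hlen : ∀ i : Fin N, k ≤ i → (history ω (i + 1)).length = i := by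
      intro i hi
      rw [(hT.mono (by omega)).length_history (by omega), Nat.add_sub_cancel]
    have hget : ∀ i : Fin N, k ≤ i → (history ω (i + 1))[(k : ℕ) - 1]? = some 1 := by
      intro i hi
      rw [history_getElem?_of_takenBy hT (by omega) (by omega), hC.2]
    have hw : Wants (patch acc (k - 1) k σ₁ σ₂) ω k ↔ acc := by
      rw [Wants, patch_of_length (hlen k le_rfl), and_iff_right hT.not_isTaken,
        and_iff_left (hget k le_rfl)]
    have hafter : WinsAfter (k + 1) (patch acc (k - 1) k σ₁ σ₂) ω ↔ WinsAfter (k + 1) σ₁ ω := by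
      refine winsAfter_congr fun i hi => ?_
      have hki : k ≤ i := Fin.le_def.2 (by omega)
      rw [Wants, Wants, patch_of_eq (by rw [hlen i hki]; omega) (hget i hki)]
    rw [winsAfter_iff, hw, hafter]
    by_cases ha : acc <;> simp [ha]
  · have hget : ∀ i : Fin N, k ≤ i → (history ω (i + 1))[(k : ℕ) - 1]? ≠ some 1 := by
      intro i hi h1
      by_cases hT : TakenBy ω k
      · rw [history_getElem?_of_takenBy hT (by omega) (by omega), Option.some_inj] at h1
        exact hTC ⟨hT, hT.not_isTaken, h1⟩
      · rcases Nat.eq_zero_or_pos k with h0 | h0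
        · have := k.2
          have hlast : (1 : ℕ) ≤ nStar N := by
            have hmem : nStar N ∈ {n : ℕ | 1 ≤ n ∧ S₁ N n ≤ 1} :=
              Nat.sInf_mem ⟨N, by omega, by simp [S₁]⟩
            exact hmem.1
          omega
        · obtain ⟨p, hp⟩ : ∃ p : Fin N, (p : ℕ) + 1 = k :=
            ⟨⟨k - 1, by omega⟩, Nat.sub_add_cancel h0⟩
          rw [← hp] at hT hk'
          rw [show (k : ℕ) - 1 = p by omega,
            history_getElem?_of_not hT (by omega) (by omega), Option.some_inj] at h1
          rw [takenBy_succ, not_or] at hT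
          exact hT.2 ((isTaken_iff hk' hT.1).2 h1)
    have hw : ¬ Wants (patch acc (k - 1) k σ₁ σ₂) ω k := by
      intro hw
      by_cases hT : TakenBy ω k
      · have hl : (history ω (k + 1)).length = k := by
          rw [(hT.mono (by omega)).length_history (by omega), Nat.add_sub_cancel]
        rw [Wants, patch_of_length hl] at hw
        exact hget k le_rfl hw.2.2
      · have hT' : ¬ TakenBy ω (k + 1) := by
          rw [takenBy_succ]
          exact not_or.2 ⟨hT, hw.1⟩
        rw [Wants, patch_of_ne (by rw [length_history_of_not hT' (by omega)]; omega)
          (hget k le_rfl)] at hw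
        exact hnot ω hT hw
    have hafter : WinsAfter (k + 1) (patch acc (k - 1) k σ₁ σ₂) ω ↔ WinsAfter (k + 1) σ₂ ω := by
      refine winsAfter_congr fun i hi => ?_
      have hki : k ≤ i := Fin.le_def.2 (by omega)
      have hl := length_history ω (n := i + 1) (by omega)
      rw [Wants, Wants, patch_of_ne (by split_ifs at hl <;> omega) (hget i hki)]
    rw [winsAfter_iff]
    simp [hw, hafter]

theorem determinedBy_takenBy (n : ℕ) : DeterminedBy n {ω : Equiv.Perm (Fin N) | TakenBy ω n} :=
  determinedBy_setOf fun _ _ hs => takenBy_congr hs le_rfl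

theorem determinedBy_not_takenBy (n : ℕ) :
    DeterminedBy n {ω : Equiv.Perm (Fin N) | ¬ TakenBy ω n} :=
  determinedBy_setOf fun _ _ hs => not_congr (takenBy_congr hs le_rfl)

theorem determinedBy_takenTop (n : ℕ) : DeterminedBy n {ω : Equiv.Perm (Fin N) | TakenTop ω n} :=
  determinedBy_setOf fun _ _ hs => takenTop_congr hs le_rfl

theorem determinedBy_takenBy_not_takenTop (n : ℕ) :
    DeterminedBy n {ω : Equiv.Perm (Fin N) | TakenBy ω n ∧ ¬ TakenTop ω n} :=
  determinedBy_setOf fun _ _ hs =>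
    and_congr (takenBy_congr hs le_rfl) (not_congr (takenTop_congr hs le_rfl))

theorem cnt_takenBy (E : Set (Equiv.Perm (Fin N))) (n : ℕ) :
    cnt (E ∩ {ω | TakenBy ω n})
      = cnt (E ∩ {ω | TakenBy ω n ∧ ¬ TakenTop ω n}) + cnt (E ∩ {ω | TakenTop ω n}) := by
  rw [← cnt_inter_add_diff _ {ω | TakenTop ω n}, add_comm]
  congr 2
  · ext ω
    simp only [Set.mem_inter_iff, Set.mem_sdiff, Set.mem_ofPred_eq]
    tauto
  · ext ω
    have := @TakenTop.takenBy N ω n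
    simp only [Set.mem_inter_iff, Set.mem_ofPred_eq]
    tauto

/-- Player 1 has accepted one of the objects before `k`, and Player 2 takes `k` to be the best
object so far. -/
def candidateAt (k : Fin N) : Set (Equiv.Perm (Fin N)) := {ω | TakenBy ω k ∧ IsCandidate ω k}

theorem determinedBy_candidateAt (k : Fin N) : DeterminedBy ((k : ℕ) + 1) (candidateAt k) :=
  determinedBy_setOf fun _ _ hs =>
    and_congr (takenBy_congr hs (by omega)) (isCandidate_congr hs (by omega))

section Transitions

variable {k : Fin N} {E : Set (Equiv.Perm (Fin N))}

theorem cnt_candidateAt_not_takenBy :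
    cnt ((E ∩ candidateAt k) ∩ {ω | ¬ TakenBy ω (k + 1)}) = 0 := by
  rw [← cnt_empty (N := N)]
  congr 1
  ext ω
  simp only [Set.mem_inter_iff, Set.mem_ofPred_eq, Set.mem_empty_iff_false, iff_false]
  exact fun h => h.2 (h.1.2.1.mono (by omega))

theorem cnt_candidateAt_not_takenTop (hE : DeterminedBy (k : ℕ) E) :
    cnt ((E ∩ candidateAt k) ∩ {ω | TakenBy ω (k + 1) ∧ ¬ TakenTop ω (k + 1)})
      = cnt (E ∩ {ω | TakenBy ω k}) / ((k : ℕ) + 1) := by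
  rw [← cnt_relRank (hE.inter (determinedBy_takenBy _)) le_rfl (by omega)]
  congr 1
  ext ω
  simp only [Set.mem_inter_iff, Set.mem_ofPred_eq, candidateAt]
  by_cases hP : TakenTop ω k
  · have := hP.takenBy
    have := this.mono (Nat.le_succ k)
    simp_all [takenTop_step hP]
  · constructor
    · rintro ⟨⟨h1, h2, h3⟩, _⟩
      exact ⟨⟨h1, h2⟩, (takenBy_not_takenTop_step h2 hP).1.1 h3⟩
    · rintro ⟨⟨h1, h2⟩, h3⟩
      have h4 := takenBy_not_takenTop_step h2 hP
      exact ⟨⟨h1, h2, h4.1.2 h3⟩, h2.mono (by omega), h4.2⟩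

theorem cnt_candidateAt_takenTop (hk : 1 ≤ (k : ℕ)) (hE : DeterminedBy (k : ℕ) E) :
    cnt ((E ∩ candidateAt k) ∩ {ω | TakenTop ω (k + 1)})
      = cnt (E ∩ {ω | TakenTop ω k}) / ((k : ℕ) + 1) := by
  rw [← cnt_relRank (hE.inter (determinedBy_takenTop _)) (r := 2) (by omega) (by omega)]
  congr 1
  ext ω
  simp only [Set.mem_inter_iff, Set.mem_ofPred_eq, candidateAt]
  constructor
  · rintro ⟨⟨h1, h2, h3⟩, h4⟩
    by_cases hP : TakenTop ω k
    · have h5 := takenTop_step hP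
      exact ⟨⟨h1, hP⟩, (h5.1.1 h3).resolve_left (h5.2.1 h4)⟩
    · exact absurd h4 (takenBy_not_takenTop_step h2 hP).2
  · rintro ⟨⟨h1, hP⟩, h2⟩
    have h5 := takenTop_step hP
    exact ⟨⟨h1, hP.takenBy, h5.1.2 (Or.inr h2)⟩, h5.2.2 (by omega)⟩

theorem cnt_diff_candidateAt_not_takenBy (hk : nStar N ≤ k + 1) (hE : DeterminedBy (k : ℕ) E) :
    cnt ((E \ candidateAt k) ∩ {ω | ¬ TakenBy ω (k + 1)})
      = k * cnt (E ∩ {ω | ¬ TakenBy ω k}) / ((k : ℕ) + 1) := by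
  rw [← cnt_relRank_ne (hE.inter (determinedBy_not_takenBy _))]
  congr 1
  ext ω
  simp only [Set.mem_inter_iff, Set.mem_sdiff, Set.mem_ofPred_eq, candidateAt]
  by_cases hT : TakenBy ω k
  · have := hT.mono (Nat.le_succ k)
    simp_all
  · simp [hT, (not_takenBy_step hk hT).1]

theorem cnt_diff_candidateAt_not_takenTop (hk : nStar N ≤ k + 1) (hE : DeterminedBy (k : ℕ) E) :
    cnt ((E \ candidateAt k) ∩ {ω | TakenBy ω (k + 1) ∧ ¬ TakenTop ω (k + 1)})
      = k * cnt (E ∩ {ω | TakenBy ω k ∧ ¬ TakenTop ω k}) / ((k : ℕ) + 1) := by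
  rw [← cnt_relRank_ne (hE.inter (determinedBy_takenBy_not_takenTop _))]
  congr 1
  ext ω
  simp only [Set.mem_inter_iff, Set.mem_sdiff, Set.mem_ofPred_eq, candidateAt]
  by_cases hT : TakenBy ω k
  · have hT' := hT.mono (Nat.le_succ k)
    by_cases hP : TakenTop ω k
    · have h := takenTop_step hP
      simp only [hT, hP, h]
      tauto
    · have h := takenBy_not_takenTop_step hT hP
      simp [hT, hP, h, hT']
  · simp [hT, not_takenBy_step hk hT]

theorem cnt_diff_candidateAt_takenTop (hk1 : 1 ≤ (k : ℕ)) (hk : nStar N ≤ k + 1)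
    (hE : DeterminedBy (k : ℕ) E) :
    cnt ((E \ candidateAt k) ∩ {ω | TakenTop ω (k + 1)})
      = ((k - 1) * cnt (E ∩ {ω | TakenTop ω k}) + cnt (E ∩ {ω | ¬ TakenBy ω k}))
        / ((k : ℕ) + 1) := by
  rw [add_div, ← cnt_relRank_ne_ne hk1 (hE.inter (determinedBy_takenTop _)),
    ← cnt_relRank (hE.inter (determinedBy_not_takenBy _)) (r := 1) le_rfl (by omega), ← cnt_union]
  · congr 1
    ext ω
    simp only [Set.mem_inter_iff, Set.mem_sdiff, Set.mem_union, Set.mem_ofPred_eq, candidateAt]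
    by_cases hT : TakenBy ω k
    · by_cases hP : TakenTop ω k
      · have h := takenTop_step hP
        simp only [hT, hP, h]
        tauto
      · simp [hT, hP, takenBy_not_takenTop_step hT hP]
    · have hP : ¬ TakenTop ω k := fun h => hT h.takenBy
      simp [hT, hP, not_takenBy_step hk hT]
  · rw [Set.disjoint_left]
    rintro ω ⟨h1, _⟩ ⟨h2, _⟩
    exact h2.2 (TakenTop.takenBy h1.2)

end Transitions

theorem exists_strategy_after {n : ℕ} (hn1 : 1 ≤ n) (hn : nStar N ≤ n + 1) (hnN : n ≤ N) :
    ∀ {E : Set (Equiv.Perm (Fin N))}, DeterminedBy n E →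
    ∃ σ : Strategy, (∀ L, σ L = true → L.getLast? = some 1) ∧
      gameValue N n (cnt (E ∩ {ω | ¬ TakenBy ω n})) (cnt (E ∩ {ω | TakenBy ω n ∧ ¬ TakenTop ω n}))
        (cnt (E ∩ {ω | TakenTop ω n})) ≤ cnt (E ∩ {ω | WinsAfter n σ ω}) := by
  induction n using downward_induction (N := N) with
  | hbase n h =>
    intro E _
    exact ⟨fun _ => false, by simp, by rw [gameValue_of_le h]; exact cnt_nonneg _⟩
  | hstep n h ih =>
    intro E hE
    obtain ⟨k, hk⟩ : ∃ k : Fin N, (k : ℕ) = n := ⟨⟨n, h⟩, rfl⟩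
    subst hk
    have hC := determinedBy_candidateAt k
    have hE' := hE.mono (Nat.le_succ k)
    obtain ⟨σ₁, h₁, w₁⟩ := ih (by omega) (by omega) (by omega) (hE'.inter hC)
    obtain ⟨σ₂, h₂, w₂⟩ := ih (by omega) (by omega) (by omega) (hE'.diff hC)
    rw [cnt_candidateAt_not_takenBy, cnt_candidateAt_not_takenTop hE,
      cnt_candidateAt_takenTop hn1 hE, cnt_takenBy] at w₁
    rw [cnt_diff_candidateAt_not_takenBy hn hE, cnt_diff_candidateAt_not_takenTop hn hE,
      cnt_diff_candidateAt_takenTop hn1 hn hE] at w₂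
    have hab := cnt_takenBy E k
    rw [gameValue_of_lt h]
    generalize cnt (E ∩ {ω | ¬ TakenBy ω k}) = c at *
    generalize cnt (E ∩ {ω | TakenBy ω k ∧ ¬ TakenTop ω k}) = a at *
    generalize cnt (E ∩ {ω | TakenTop ω k}) = b at *
    obtain ⟨σ, hσ, hw⟩ := exists_patch hn (gameValue N (k + 1) 0 ((a + b) / ((k : ℕ) + 1))
      (b / ((k : ℕ) + 1)) ≤ (a + b) / N) h₁ h₂
    refine ⟨σ, hσ, ?_⟩
    rw [← cnt_inter_add_diff (E ∩ {ω | WinsAfter k σ ω}) (candidateAt k), add_comm]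
    refine add_le_add ?_ (w₂.trans (cnt_mono ?_))
    · by_cases hacc : gameValue N (k + 1) 0 ((a + b) / ((k : ℕ) + 1))
        (b / ((k : ℕ) + 1)) ≤ (a + b) / N
      · rw [max_eq_left hacc]
        simp only [if_pos hacc] at hw
        have hT := hE.inter (determinedBy_takenBy k)
        have hb1 := cnt_best (k := k) (k + 1) (by omega) (by omega)
          (E := (E ∩ {ω | TakenBy ω k}) ∩ {ω | relRank ω k = 1})
          ((hT.mono (by omega)).inter (determinedBy_setOf fun ω ω' hs => by
            rw [relRank_congr hs (by omega)]))
          (fun ω hω j hj => relRank_eq_one_iff.1 hω.2 j (Fin.le_def.2 (by omega)))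
        rw [cnt_relRank hT le_rfl (by omega), hab] at hb1
        have : ((k : ℕ) : ℝ) + 1 ≠ 0 := by positivity
        have e3 : (((k : ℕ) + 1 : ℕ) : ℝ) * ((a + b) / ((k : ℕ) + 1)) / N = (a + b) / N := by
          push_cast
          field_simp
        rw [e3] at hb1
        rw [← hb1]
        refine cnt_mono ?_
        rintro ω ⟨⟨⟨hωE, hωT⟩, hωr⟩, hω0⟩
        have hC : IsCandidate ω k := by
          by_cases hP : TakenTop ω k
          · exact (takenTop_step hP).1.2 (Or.inl hωr)
          · exact (takenBy_not_takenTop_step hωT hP).1.2 hωr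
        exact ⟨⟨hωE, ((hw ω).1 hωT hC).2 hω0⟩, hωT, hC⟩
      · rw [max_eq_right (not_le.1 hacc).le]
        simp only [if_neg hacc] at hw
        refine w₁.trans (cnt_mono ?_)
        rintro ω ⟨hωD, hωw⟩
        exact ⟨⟨hωD.1, ((hw ω).1 hωD.2.1 hωD.2.2).2 hωw⟩, hωD.2⟩
    · rintro ω ⟨⟨hωE, hωC⟩, hωw⟩
      exact ⟨⟨hωE, ((hw ω).2 hωC).2 hωw⟩, hωC⟩

theorem vApproxBefore_eq {n : ℕ} (h2 : 2 ≤ nStar N) (hn : n + 1 ≤ nStar N) :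
    vApproxBefore N n = (∑ k ∈ Finset.Ico (n + 1) (nStar N),
      nextBestProb n k * max ((k : ℝ) / N) (vApproxBefore N k))
    + vApproxBefore N (nStar N - 1) * ((n : ℝ) / ((nStar N : ℝ) - 1)) := by
  rcases eq_or_lt_of_le hn with h | h
  · have e : nStar N - 1 = n := by omega
    have h1 : (2 : ℝ) ≤ nStar N := by exact_mod_cast h2
    have e' : (n : ℝ) = nStar N - 1 := by rw [← h]; push_cast; ring
    rw [h, Finset.Ico_self, Finset.sum_empty, zero_add, e, e', div_self (by linarith), mul_one]
  · conv_lhs => rw [vApproxBefore, if_neg (by omega)]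
    rw [Finset.sum_attach (Finset.Ico (n + 1) (nStar N))
      (fun k => nextBestProb n k * max ((k : ℝ) / N) (vApproxBefore N k))]

theorem vApproxBefore_step {n : ℕ} (hn : n + 1 < nStar N) :
    vApproxBefore N n = n / (n + 1) * vApproxBefore N (n + 1)
      + 1 / (n + 1) * max (((n : ℝ) + 1) / N) (vApproxBefore N (n + 1)) := by
  rw [vApproxBefore_eq (by omega) hn.le]
  rw [Finset.sum_eq_sum_Ico_succ_bot hn]
  have e1 : nextBestProb n (n + 1) = 1 / (n + 1) := by
    rw [nextBestProb]
    split_ifs with h1 h2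
    · simp [h1]
    · omega
    · push_cast
      have : (n : ℝ) ≠ 0 := by exact_mod_cast h1
      rw [add_sub_cancel_right]
      field_simp
  have e2 : ∑ k ∈ Finset.Ico (n + 1 + 1) (nStar N),
      nextBestProb n k * max ((k : ℝ) / N) (vApproxBefore N k)
      = n / (n + 1) * ∑ k ∈ Finset.Ico (n + 1 + 1) (nStar N),
      nextBestProb (n + 1) k * max ((k : ℝ) / N) (vApproxBefore N k) := by
    rw [Finset.mul_sum]
    refine Finset.sum_congr rfl fun k hk => ?_
    have hk := (Finset.mem_Ico.1 hk).1
    rw [← mul_assoc]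
    congr 1
    rw [nextBestProb, nextBestProb, if_neg (by omega : n + 1 ≠ 0)]
    split_ifs with h1 h2
    · omega
    · simp [h1]
    · push_cast
      field_simp
  have e3 := vApproxBefore_eq (N := N) (n := n + 1) (by omega) (by omega)
  rw [e1, e2]
  have e4 : vApproxBefore N (nStar N - 1) * ((n : ℝ) / ((nStar N : ℝ) - 1))
      = n / (n + 1) * (vApproxBefore N (nStar N - 1)
        * (((n + 1 : ℕ) : ℝ) / ((nStar N : ℝ) - 1))) := by
    push_cast
    field_simp
  rw [e4]
  push_cast at e3 ⊢
  linear_combination (-(n : ℝ) / (n + 1)) * e3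

theorem vApproxBefore_le_gameValue {n : ℕ} (hn1 : 1 ≤ n) (hn : nStar N ≤ n + 1) :
    vApproxBefore N n ≤ gameValue N n 1 0 0 := by
  rw [vApproxBefore, if_pos hn]
  exact sum_div_le_gameValue n hn1

theorem exists_strategy_of_not_takenBy {n : ℕ} (hn1 : 1 ≤ n) (hn : nStar N ≤ n + 1)
    (hnN : n ≤ N) {E : Set (Equiv.Perm (Fin N))} (hE : DeterminedBy n E)
    (hET : ∀ ω ∈ E, ¬ TakenBy ω n) :
    ∃ σ : Strategy, vApproxBefore N n * cnt E ≤ cnt (E ∩ {ω | WinsAfter n σ ω}) := by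
  obtain ⟨σ, _, hσ⟩ := exists_strategy_after hn1 hn hnN hE
  refine ⟨σ, le_trans ?_ hσ⟩
  have e1 : E ∩ {ω | ¬ TakenBy ω n} = E := Set.inter_eq_left.2 hET
  have e2 : E ∩ {ω | TakenBy ω n ∧ ¬ TakenTop ω n} = ∅ := by
    ext ω
    have := hET ω
    simp only [Set.mem_inter_iff, Set.mem_ofPred_eq, Set.mem_empty_iff_false]
    tauto
  have e3 : E ∩ {ω | TakenTop ω n} = ∅ := by
    ext ω
    have := hET ω
    have := @TakenTop.takenBy N ω n
    simp only [Set.mem_inter_iff, Set.mem_ofPred_eq, Set.mem_empty_iff_false]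
    tauto
  rw [e1, e2, e3, cnt_empty]
  have := gameValue_smul N n (cnt_nonneg E) 1 0 0
  rw [mul_one, mul_zero] at this
  rw [this, mul_comm]
  exact mul_le_mul_of_nonneg_left (vApproxBefore_le_gameValue hn1 hn) (cnt_nonneg E)

theorem exists_strategy_before {n : ℕ} (h2 : 2 ≤ nStar N) (hN : nStar N ≤ N)
    (hn : n + 1 ≤ nStar N) {E : Set (Equiv.Perm (Fin N))} (hE : DeterminedBy n E) :
    ∃ σ : Strategy, vApproxBefore N n * cnt E ≤ cnt (E ∩ {ω | WinsAfter n σ ω}) := by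
  induction hl : nStar N - (n + 1) generalizing n E with
  | zero =>
    exact exists_strategy_of_not_takenBy (by omega) (by omega) (by omega) hE
      fun ω _ hT => by have := hT.nStar_le; omega
  | succ l ih =>
    obtain ⟨k, hk⟩ : ∃ k : Fin N, (k : ℕ) = n := ⟨⟨n, by omega⟩, rfl⟩
    subst hk
    have dR : DeterminedBy ((k : ℕ) + 1) {ω : Equiv.Perm (Fin N) | relRank ω k = 1} :=
      determinedBy_setOf fun ω ω' hs => by rw [relRank_congr hs (by omega)]
    have hD := (hE.mono (Nat.le_succ _)).inter dR
    have hD' := (hE.mono (Nat.le_succ _)).diff dR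
    obtain ⟨σ₁, w₁⟩ := ih (by omega) hD (by omega)
    obtain ⟨σ₂, w₂⟩ := ih (by omega) hD' (by omega)
    set v := vApproxBefore N (k + 1) with hv
    have hT : ∀ ω : Equiv.Perm (Fin N), ¬ TakenBy ω (k + 1) := fun ω hT => by
      have := hT.nStar_le
      omega
    set σ := patch (v ≤ ((k : ℕ) + 1 : ℝ) / N) k (k + 1) σ₁ σ₂ with hσ
    have hget : ∀ (ω : Equiv.Perm (Fin N)) (i : Fin N), k ≤ i →
        (history ω (i + 1))[(k : ℕ)]? = some (relRank ω k) :=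
      fun ω i hi => history_getElem?_of_not (hT ω) (by omega) (by omega)
    have hwk : ∀ ω : Equiv.Perm (Fin N),
        Wants σ ω k ↔ v ≤ ((k : ℕ) + 1 : ℝ) / N ∧ relRank ω k = 1 := by
      intro ω
      rw [Wants, hσ, patch_of_length (length_history_of_not (hT ω) (by omega)),
        hget ω k le_rfl, Option.some_inj]
      have := hT ω
      rw [takenBy_succ] at this
      tauto
    have hlen : ∀ (ω : Equiv.Perm (Fin N)) (i : Fin N), k < i → ¬ IsTaken ω i →
        (history ω (i + 1)).length ≠ k + 1 := by
      intro ω i hi hiT hl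
      by_cases hT' : TakenBy ω (i + 1)
      · rw [hT'.length_history (by omega)] at hl
        rw [takenBy_succ, or_iff_left hiT] at hT'
        have := hT'.nStar_le
        omega
      · rw [length_history_of_not hT' (by omega)] at hl
        omega
    have hw₁ : ∀ ω : Equiv.Perm (Fin N), relRank ω k = 1 →
        (WinsAfter (k + 1) σ ω ↔ WinsAfter (k + 1) σ₁ ω) := by
      refine fun ω hr => winsAfter_congr fun i hi => and_congr_right fun hiT => ?_
      have hki : k < i := Fin.lt_def.2 (by omega)
      rw [hσ, patch_of_eq (hlen ω i hki hiT) (by rw [hget ω i hki.le, hr])]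
    have hw₂ : ∀ ω : Equiv.Perm (Fin N), relRank ω k ≠ 1 →
        (WinsAfter (k + 1) σ ω ↔ WinsAfter (k + 1) σ₂ ω) := by
      refine fun ω hr => winsAfter_congr fun i hi => and_congr_right fun hiT => ?_
      have hki : k < i := Fin.lt_def.2 (by omega)
      rw [hσ, patch_of_ne (hlen ω i hki hiT) (by rw [hget ω i hki.le]; simpa using hr)]
    refine ⟨σ, ?_⟩
    have ne0 : ((k : ℕ) : ℝ) + 1 ≠ 0 := by positivity
    have c1 := cnt_relRank hE (r := 1) le_rfl (by omega)
    have c2 := cnt_inter_add_diff E {ω : Equiv.Perm (Fin N) | relRank ω k = 1}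
    rw [vApproxBefore_step (by omega), ← hv,
      ← cnt_inter_add_diff (E ∩ {ω | WinsAfter k σ ω}) {ω | relRank ω k = 1}]
    have hsplit : ((k : ℕ) / ((k : ℕ) + 1) * v
        + 1 / ((k : ℕ) + 1) * max (((k : ℕ) + 1 : ℝ) / N) v) * cnt E
        = max (((k : ℕ) + 1 : ℝ) / N) v * cnt (E ∩ {ω | relRank ω k = 1})
          + v * cnt (E \ {ω | relRank ω k = 1}) := by
      have : cnt (E \ {ω | relRank ω k = 1}) = cnt E - cnt E / ((k : ℕ) + 1) := by linarith
      rw [this, c1]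
      field_simp
      ring
    rw [hsplit]
    refine add_le_add ?_ ?_
    · by_cases hacc : v ≤ ((k : ℕ) + 1 : ℝ) / N
      · rw [max_eq_left hacc]
        have hb := cnt_best (k := k) (k + 1) (by omega) (by omega) hD
          (fun ω hω j hj => relRank_eq_one_iff.1 hω.2 j (Fin.le_def.2 (by omega)))
        refine le_trans (le_of_eq ?_) (hb.symm.le.trans (cnt_mono ?_))
        · push_cast
          ring
        · rintro ω ⟨⟨hωE, hωr⟩, hω0⟩
          exact ⟨⟨hωE, winsAfter_iff.2 (Or.inl ⟨(hwk ω).2 ⟨hacc, hωr⟩, hω0⟩)⟩, hωr⟩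
      · rw [max_eq_right (not_le.1 hacc).le]
        refine w₁.trans (cnt_mono ?_)
        rintro ω ⟨⟨hωE, hωr⟩, hωw⟩
        exact ⟨⟨hωE, winsAfter_iff.2 (Or.inr ⟨fun h => hacc ((hwk ω).1 h).1,
          (hw₁ ω hωr).2 hωw⟩)⟩, hωr⟩
    · refine w₂.trans (cnt_mono ?_)
      rintro ω ⟨⟨hωE, hωr⟩, hωw⟩
      exact ⟨⟨hωE, winsAfter_iff.2 (Or.inr ⟨fun h => hωr ((hwk ω).1 h).2,
        (hw₂ ω hωr).2 hωw⟩)⟩, hωr⟩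

/-! ## The conditional probability that the object of Player 1 is not the best so far -/

theorem takenBy_of_isCandidate {ω : Equiv.Perm (Fin N)} {i : Fin N} (h : IsCandidate ω i)
    (hi : nStar N ≤ i + 1) : TakenBy ω i := by
  by_contra hT
  have hT' : ¬ TakenBy ω (i + 1) := by
    rw [takenBy_succ]
    exact not_or.2 ⟨hT, h.1⟩
  exact h.1 ((isTaken_iff hi hT).2 ((seenRank_eq_relRank hT').symm.trans h.2))

theorem candidateCount_succ_le (ω : Equiv.Perm (Fin N)) (k : Fin N) :
    candidateCount ω (k + 1) ≤ candidateCount ω k + if IsCandidate ω k then 1 else 0 := by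
  have hsub : Finset.univ.filter
      (fun i : Fin N => nStar N < (i : ℕ) + 1 ∧ (i : ℕ) + 1 ≤ k + 1 ∧ IsCandidate ω i)
      ⊆ Finset.univ.filter
        (fun i : Fin N => nStar N < (i : ℕ) + 1 ∧ (i : ℕ) + 1 ≤ k ∧ IsCandidate ω i)
        ∪ if IsCandidate ω k then {k} else ∅ := by
    intro i hi
    simp only [Finset.mem_filter, Finset.mem_univ, true_and, Finset.mem_union] at hi ⊢
    obtain ⟨h1, h2, h3⟩ := hi
    rcases Nat.lt_or_ge i k with hik | hik
    · exact Or.inl ⟨h1, hik, h3⟩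
    · obtain rfl : i = k := Fin.ext (by omega)
      simp [h3]
  refine (Finset.card_le_card hsub).trans ((Finset.card_union_le _ _).trans ?_)
  refine Nat.add_le_add_left ?_ _
  split_ifs <;> simp

theorem seenRank_le_of_takenBy {ω : Equiv.Perm (Fin N)} {k : Fin N} (h : TakenBy ω k) :
    seenRank ω k ≤ k := by
  obtain ⟨t, ht, hT⟩ := h
  have hsub : Finset.univ.filter (fun j : Fin N => j ≤ k ∧ ¬ IsTaken ω j ∧ ω j ≤ ω k)
      ⊆ (Finset.Iic k).erase t := by
    intro j hj
    simp only [Finset.mem_filter, Finset.mem_univ, true_and] at hj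
    refine Finset.mem_erase.2 ⟨?_, Finset.mem_Iic.2 hj.1⟩
    rintro rfl
    exact hj.2.1 hT
  refine (Finset.card_le_card hsub).trans ?_
  rw [Finset.card_erase_of_mem (Finset.mem_Iic.2 (Fin.le_def.2 (by omega))), Fin.card_Iic]
  omega

/-- The rank, among the objects before `k`, of the object that Player 1 has accepted. -/
def takenRank (k : Fin N) (ω : Equiv.Perm (Fin N)) : ℕ :=
  (Finset.univ.filter (fun j : Fin N => j < k ∧ ∃ t, t < k ∧ IsTaken ω t ∧ ω j ≤ ω t)).card

theorem takenRank_congr {k : Fin N} {ω ω' : Equiv.Perm (Fin N)} (h : SameOrder k ω ω') :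
    takenRank k ω = takenRank k ω' := by
  rw [takenRank, takenRank]
  congr 1
  refine Finset.filter_congr fun j _ => and_congr_right fun hj => exists_congr fun t =>
    and_congr_right fun ht => ?_
  rw [isTaken_congr h ht, h j t hj ht]

theorem takenRank_eq {k t : Fin N} {ω : Equiv.Perm (Fin N)} (ht : t < k) (hT : IsTaken ω t) :
    takenRank k ω = (Finset.univ.filter (fun j : Fin N => j < k ∧ ω j ≤ ω t)).card := by
  rw [takenRank]
  congr 1
  refine Finset.filter_congr fun j _ => and_congr_right fun _ => ?_
  constructor
  · rintro ⟨t', _, h1, h2⟩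
    obtain rfl := isTaken_unique h1 hT
    exact h2
  · exact fun h => ⟨t, ht, hT, h⟩

/-- The relative rank of object `k` for which Player 2 observes the rank `s`. -/
theorem seenRank_eq_of_relRank {k : Fin N} {ω : Equiv.Perm (Fin N)} (h : TakenBy ω k) {s : ℕ}
    (hr : relRank ω k = if s ≤ takenRank k ω then s else s + 1) : seenRank ω k = s := by
  obtain ⟨t, ht, hT⟩ := h
  have htk : t < k := Fin.lt_def.2 (by omega)
  have hsum := relRank_eq_seenRank_add hT htk.le
  have hτ := takenRank_eq htk hT
  by_cases hlt : ω t ≤ ω k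
  · rw [if_pos hlt] at hsum
    have : takenRank k ω + 1 ≤ relRank ω k := by
      rw [hτ, relRank, ← Finset.card_insert_of_notMem
        (s := Finset.univ.filter (fun j : Fin N => j < k ∧ ω j ≤ ω t)) (a := k) (by simp)]
      refine Finset.card_le_card fun j hj => ?_
      simp only [Finset.mem_insert, Finset.mem_filter, Finset.mem_univ, true_and] at hj ⊢
      rcases hj with rfl | ⟨h1, h2⟩
      · exact ⟨le_rfl, le_rfl⟩
      · exact ⟨h1.le, h2.trans hlt⟩
    split_ifs at hr <;> omega
  · rw [if_neg hlt] at hsum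
    have : relRank ω k ≤ takenRank k ω := by
      have hsub : Finset.univ.filter (fun j : Fin N => j ≤ k ∧ ω j ≤ ω k) ⊆
          insert k ((Finset.univ.filter (fun j : Fin N => j < k ∧ ω j ≤ ω t)).erase t) := by
        intro j hj
        simp only [Finset.mem_insert, Finset.mem_filter, Finset.mem_univ, true_and,
          Finset.mem_erase] at hj ⊢
        rcases eq_or_lt_of_le hj.1 with h1 | h1
        · exact Or.inl h1
        · refine Or.inr ⟨?_, h1, hj.2.trans (not_le.1 hlt).le⟩
          rintro rfl
          exact hlt hj.2
      have hmem : t ∈ Finset.univ.filter (fun j : Fin N => j < k ∧ ω j ≤ ω t) := by simp [htk]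
      have := Finset.card_pos.2 ⟨t, hmem⟩
      have h1 := (Finset.card_le_card hsub).trans (Finset.card_insert_le _ _)
      rw [Finset.card_erase_of_mem hmem] at h1
      rw [hτ]
      exact h1.trans (by omega)
    split_ifs at hr <;> omega

theorem cnt_relRank_le {k : Fin N} {E : Set (Equiv.Perm (Fin N))} (hE : DeterminedBy k E)
    (r : ℕ) : cnt (E ∩ {ω | relRank ω k = r}) ≤ cnt E / ((k : ℕ) + 1) := by
  by_cases hr : 1 ≤ r ∧ r ≤ k + 1
  · exact (cnt_relRank hE hr.1 hr.2).le
  · have : E ∩ {ω | relRank ω k = r} = ∅ := by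
      refine Set.eq_empty_of_forall_notMem ?_
      rintro ω ⟨_, hω⟩
      have h1 := relRank_pos ω k
      have h2 := relRank_le ω k
      rw [Set.mem_ofPred_eq] at hω
      omega
    rw [this, cnt_empty]
    exact div_nonneg (cnt_nonneg _) (by positivity)

/-- The realizations in which Player 2 has the same history at moment `n` as in `ω`. -/
def historyClass (ω : Equiv.Perm (Fin N)) (n : ℕ) : Set (Equiv.Perm (Fin N)) :=
  {ω' | history ω' n = history ω n}

theorem determinedBy_historyClass (ω : Equiv.Perm (Fin N)) (n : ℕ) :
    DeterminedBy n (historyClass ω n) :=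
  determinedBy_setOf fun _ _ hs => by rw [history_congr hs le_rfl]

theorem takenBy_of_mem_historyClass {ω ω' : Equiv.Perm (Fin N)} {n : ℕ} (hn : n ≤ N)
    (h : TakenBy ω n) (h' : ω' ∈ historyClass ω n) : TakenBy ω' n := by
  by_contra hT
  have h1 := h.length_history hn
  have h2 := length_history_of_not hT hn
  have : history ω' n = history ω n := h'
  rw [this] at h2
  obtain ⟨i, hi, _⟩ := h
  omega

theorem historyClass_succ {ω : Equiv.Perm (Fin N)} {k : Fin N} (hT : TakenBy ω k)
    (hc : candidateCount ω (k + 1) ≠ 0) :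
    historyClass ω (k + 1) = historyClass ω k ∩ {ω' | seenRank ω' k = seenRank ω k} := by
  ext ω'
  simp only [historyClass, Set.mem_inter_iff, Set.mem_ofPred_eq]
  constructor
  · intro h
    have hT1 : TakenBy ω' (k + 1) :=
      takenBy_of_mem_historyClass (by omega) (hT.mono (by omega)) h
    have hT' : TakenBy ω' k := by
      by_contra hT'
      obtain ⟨i, hi⟩ := Finset.card_ne_zero.1 hc
      simp only [Finset.mem_filter, Finset.mem_univ, true_and] at hi
      obtain ⟨h1, h2, h3⟩ := hi
      have hTi := takenBy_of_isCandidate h3 h1.le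
      have hi0 : 1 ≤ (i : ℕ) := by
        obtain ⟨j, hj, _⟩ := hTi
        omega
      obtain ⟨p, hp⟩ : ∃ p : Fin N, (p : ℕ) + 1 = i :=
        ⟨⟨i - 1, by omega⟩, Nat.sub_add_cancel hi0⟩
      have hTp : ¬ TakenBy ω' (p + 1) := fun h => hT' (h.mono (by omega))
      have e1 := history_getElem?_of_takenBy hTi h2 (by omega)
      have e2 := history_getElem?_of_not hTp (n := k + 1) (by omega) (by omega)
      rw [h, show (p : ℕ) = i - 1 by omega, e1, Option.some_inj, h3.2] at e2
      rw [takenBy_succ, not_or] at hTp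
      exact hTp.2 ((isTaken_iff (by omega) hTp.1).2 e2.symm)
    rw [history_succ, history_succ, if_neg hT.not_isTaken, if_neg hT'.not_isTaken] at h
    have := List.append_inj' h rfl
    exact ⟨this.1, by simpa using this.2⟩
  · rintro ⟨h1, h2⟩
    have hT' := takenBy_of_mem_historyClass (by omega) hT h1
    rw [history_succ, history_succ, if_neg hT.not_isTaken, if_neg hT'.not_isTaken, h1, h2]

theorem candidateCount_mul_cnt_le {n : ℕ} (hn : n ≤ N) (ω : Equiv.Perm (Fin N))
    (hT : TakenBy ω n) :
    candidateCount ω n * cnt (historyClass ω n ∩ {ω' | TakenTop ω' n})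
      ≤ cnt (historyClass ω n ∩ {ω' | TakenBy ω' n ∧ ¬ TakenTop ω' n}) := by
  induction n with
  | zero =>
    obtain ⟨i, hi, _⟩ := hT
    omega
  | succ n ih =>
    obtain ⟨k, hk⟩ : ∃ k : Fin N, (k : ℕ) = n := ⟨⟨n, by omega⟩, rfl⟩
    subst hk
    by_cases hc : candidateCount ω (k + 1) = 0
    · rw [hc, Nat.cast_zero, zero_mul]
      exact cnt_nonneg _
    have hTk : TakenBy ω k := by
      obtain ⟨i, hi⟩ := Finset.card_ne_zero.1 hc
      simp only [Finset.mem_filter, Finset.mem_univ, true_and] at hi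
      exact (takenBy_of_isCandidate hi.2.2 hi.1.le).mono (by omega)
    have ih := ih (by omega) hTk
    have hk1 : 1 ≤ (k : ℕ) := by
      obtain ⟨j, hj, _⟩ := hTk
      omega
    rw [historyClass_succ hTk hc]
    have hE := determinedBy_historyClass ω k
    have hET : ∀ ω' ∈ historyClass ω k, TakenBy ω' k :=
      fun ω' h => takenBy_of_mem_historyClass (by omega) hTk h
    generalize historyClass ω k = E at *
    have hcount := candidateCount_succ_le ω k
    have hpos : (0 : ℝ) < (k : ℕ) + 1 := by positivity
    have hb0 := cnt_nonneg (E ∩ {ω' | TakenTop ω' k})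
    by_cases hC : IsCandidate ω k
    · have e : E ∩ {ω' | seenRank ω' k = seenRank ω k} = E ∩ candidateAt k := by
        ext ω'
        simp only [Set.mem_inter_iff, candidateAt, Set.mem_ofPred_eq, hC.2, IsCandidate]
        constructor
        · exact fun h => ⟨h.1, hET ω' h.1, (hET ω' h.1).not_isTaken, h.2⟩
        · exact fun h => ⟨h.1, h.2.2.2⟩
      rw [e, cnt_candidateAt_not_takenTop hE, cnt_candidateAt_takenTop hk1 hE, cnt_takenBy,
        ← mul_div_assoc]
      rw [if_pos hC] at hcount
      have hcount' : (candidateCount ω (k + 1) : ℝ) ≤ candidateCount ω k + 1 := by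
        exact_mod_cast hcount
      gcongr
      nlinarith
    · rw [if_neg hC, add_zero] at hcount
      have hcount' : (candidateCount ω (k + 1) : ℝ) ≤ candidateCount ω k := by
        exact_mod_cast hcount
      have hs1 : seenRank ω k ≠ 1 := fun h => hC ⟨hTk.not_isTaken, h⟩
      have hs0 : 1 ≤ seenRank ω k :=
        Finset.card_pos.2 ⟨k, by simp [hTk.not_isTaken]⟩
      have hsk := seenRank_le_of_takenBy hTk
      generalize seenRank ω k = s at *
      have hP : cnt ((E ∩ {ω' | seenRank ω' k = s}) ∩ {ω' | TakenTop ω' (k + 1)})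
          ≤ cnt (E ∩ {ω' | TakenTop ω' k}) / ((k : ℕ) + 1) := by
        refine le_trans (cnt_mono ?_)
          (cnt_relRank_le (hE.inter (determinedBy_takenTop k)) (s + 1))
        rintro ω' ⟨⟨h1, h2⟩, h3⟩
        have hT' := hET ω' h1
        have hPk : TakenTop ω' k := by
          by_contra hPk
          exact (takenBy_not_takenTop_step hT' hPk).2 h3
        refine ⟨⟨h1, hPk⟩, ?_⟩
        obtain ⟨t, ht, hTt, htop⟩ := h3
        have htk : t ≤ k := Fin.le_def.2 (by omega)
        have := relRank_eq_seenRank_add hTt htk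
        rw [if_pos (htop k le_rfl)] at this
        rw [Set.mem_ofPred_eq] at h2 ⊢
        rw [this, h2]
      have hM : cnt (E ∩ {ω' | TakenBy ω' k ∧ ¬ TakenTop ω' k}) / ((k : ℕ) + 1)
          ≤ cnt ((E ∩ {ω' | seenRank ω' k = s})
            ∩ {ω' | TakenBy ω' (k + 1) ∧ ¬ TakenTop ω' (k + 1)}) := by
        rw [← cnt_relRank_eq (hE.inter (determinedBy_takenBy_not_takenTop k))
          (r := fun ω' => if s ≤ takenRank k ω' then s else s + 1)
          (fun ω' => by split_ifs <;> omega) (fun ω' ω'' h => by rw [takenRank_congr h])]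
        refine cnt_mono ?_
        rintro ω' ⟨⟨h1, h2, h3⟩, h4⟩
        exact ⟨⟨h1, seenRank_eq_of_relRank h2 h4⟩, h2.mono (by omega),
          (takenBy_not_takenTop_step h2 h3).2⟩
      refine le_trans (mul_le_mul hcount' hP (cnt_nonneg _) (Nat.cast_nonneg _)) (le_trans ?_ hM)
      rw [← mul_div_assoc]
      gcongr

/-! ## Lower bounds for the optimal rewards -/

theorem le_optimalReward {n : ℕ} {E : Set (Equiv.Perm (Fin N))} (hE : E.Nonempty) {v : ℝ}
    (h : ∃ σ : Strategy, v * cnt E ≤ cnt (E ∩ {ω | WinsAfter n σ ω})) :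
    v ≤ optimalReward n E := by
  obtain ⟨σ, hσ⟩ := h
  have hpos := cnt_pos hE
  have hbdd : BddAbove (Set.range fun σ : Strategy => condProb {ω | WinsAfter n σ ω} E) := by
    refine ⟨1, ?_⟩
    rintro _ ⟨σ, rfl⟩
    exact (div_le_one hpos).2 (cnt_mono Set.inter_subset_right)
  refine le_trans ?_ (le_ciSup hbdd σ)
  rw [Set.inter_comm] at hσ
  exact (le_div_iff₀ hpos).2 hσ

theorem exists_strategy_of_takenBy {n m : ℕ} (h2 : 2 ≤ n) (hn : nStar N ≤ n + 1) (hnN : n ≤ N)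
    {E : Set (Equiv.Perm (Fin N))} (hE : DeterminedBy n E) (hET : ∀ ω ∈ E, TakenBy ω n)
    (hm : m * cnt (E ∩ {ω | TakenTop ω n}) ≤ cnt (E ∩ {ω | TakenBy ω n ∧ ¬ TakenTop ω n})) :
    ∃ σ : Strategy, vApprox N n m * cnt E ≤ cnt (E ∩ {ω | WinsAfter n σ ω}) := by
  obtain ⟨σ, _, hσ⟩ := exists_strategy_after (by omega) hn hnN hE
  refine ⟨σ, le_trans ?_ hσ⟩
  have e1 : E ∩ {ω | ¬ TakenBy ω n} = ∅ :=
    Set.eq_empty_of_forall_notMem fun ω h => h.2 (hET ω h.1)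
  have e2 := cnt_takenBy E n
  have e3 : E ∩ {ω | TakenBy ω n} = E := Set.inter_eq_left.2 hET
  rw [e3] at e2
  rw [e1, cnt_empty, e2]
  exact vApprox_mul_le_gameValue n h2 m (cnt_nonneg _) hm

theorem vApproxBefore_le_vBefore (hN : 3 ≤ N) {n : ℕ} (hn : n ≤ N) :
    vApproxBefore N n ≤ vBefore N n := by
  have h2 := two_le_nStar hN
  have hE := determinedBy_not_takenBy (N := N) n
  refine le_optimalReward ⟨1, ?_⟩ ?_
  · rintro ⟨i, _, hT⟩
    have h1 := relRank_eq_one_iff.1 hT.2.1 ⟨0, by omega⟩ (Fin.le_def.2 (Nat.zero_le _))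
    have h3 := hT.1
    rw [Equiv.Perm.one_apply, Equiv.Perm.one_apply, Fin.le_def] at h1
    simp only at h1
    omega
  · by_cases h : n + 1 ≤ nStar N
    · exact exists_strategy_before h2 (nStar_le N (by omega)) h hE
    · exact exists_strategy_of_not_takenBy (by omega) (by omega) hn hE fun _ h => h

theorem exists_takenBy_candidateCount_eq_zero (h2 : 2 ≤ nStar N) {n : ℕ} (hn : nStar N ≤ n)
    (hnN : n ≤ N) : ∃ ω : Equiv.Perm (Fin N), TakenBy ω n ∧ candidateCount ω n = 0 := by
  obtain ⟨q, hq⟩ : ∃ q : Fin N, (q : ℕ) + 1 = nStar N :=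
    ⟨⟨nStar N - 1, by omega⟩, Nat.sub_add_cancel (by omega)⟩
  obtain ⟨z, hz⟩ : ∃ z : Fin N, (z : ℕ) = 0 := ⟨⟨0, by omega⟩, rfl⟩
  have hqT : IsTaken (Equiv.swap z q) q := by
    refine ⟨hq.ge, relRank_eq_one_iff.2 fun j _ => ?_, fun j hj h => by omega⟩
    rw [Equiv.swap_apply_right, Fin.le_def, hz]
    exact Nat.zero_le _
  refine ⟨Equiv.swap z q, ⟨q, by omega, hqT⟩, ?_⟩
  refine Finset.card_eq_zero.2 (Finset.filter_eq_empty_iff.2 ?_)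
  rintro i _ ⟨h1, _, hC⟩
  have hzT : ¬ IsTaken (Equiv.swap z q) z := fun h => by
    have := isTaken_unique h hqT
    subst this
    omega
  have h3 := (seenRank_eq_one_iff hC.1).1 hC.2 z (Fin.le_def.2 (by omega)) hzT
  rw [Equiv.swap_apply_left, Equiv.swap_apply_of_ne_of_ne (by rintro rfl; omega)
    (by rintro rfl; omega)] at h3
  omega

theorem vApprox_le_vZero (hN : 3 ≤ N) {n : ℕ} (hn : nStar N ≤ n) (hnN : n ≤ N) :
    vApprox N n 0 ≤ vZero N n := by
  have h2 := two_le_nStar hN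
  refine le_optimalReward (exists_takenBy_candidateCount_eq_zero h2 hn hnN)
    (exists_strategy_of_takenBy (by omega) (by omega) hnN ?_ (fun _ h => h.1) ?_)
  · exact determinedBy_setOf fun ω ω' hs => by
      rw [takenBy_congr hs le_rfl, candidateCount_congr hs le_rfl]
  · rw [Nat.cast_zero, zero_mul]
    exact cnt_nonneg _

theorem vApprox_le_vAt (hN : 3 ≤ N) {m n : ℕ} {ω : Equiv.Perm (Fin N)}
    (h : IsCandidateTime ω m n) : vApprox N n m ≤ vAt ω n := by
  have h2 := two_le_nStar hN
  obtain ⟨hn, ⟨i, rfl, hC⟩, rfl⟩ := h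
  have hT : TakenBy ω (i + 1) := (takenBy_of_isCandidate hC hn.le).mono (by omega)
  exact le_optimalReward (E := historyClass ω (i + 1)) ⟨ω, rfl⟩
    (exists_strategy_of_takenBy (by omega) (by omega) (by omega) (determinedBy_historyClass ω _)
      (fun _ h => takenBy_of_mem_historyClass (by omega) hT h)
      (candidateCount_mul_cnt_le (by omega) ω hT))

end StackelbergSecretary

end

theorem lemma2 (N : ℕ) (hN : 3 ≤ N) :
    (∀ n : ℕ, n ≤ N →
      StackelbergSecretary.vApproxBefore N n ≤ StackelbergSecretary.vBefore N n) ∧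
    (∀ n : ℕ, StackelbergSecretary.nStar N ≤ n → n ≤ N →
      StackelbergSecretary.vApprox N n 0 ≤ StackelbergSecretary.vZero N n) ∧
    (∀ (m n : ℕ), 1 ≤ m → ∀ ω : Equiv.Perm (Fin N),
      StackelbergSecretary.IsCandidateTime ω m n →
      StackelbergSecretary.vApprox N n m ≤ StackelbergSecretary.vAt ω n) := by
  exact ⟨fun _ hn => StackelbergSecretary.vApproxBefore_le_vBefore hN hn,
    fun _ hn hnN => StackelbergSecretary.vApprox_le_vZero hN hn hnN,
    fun _ _ _ _ h => StackelbergSecretary.vApprox_le_vAt hN h⟩
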